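/- **Setting.** Let $T>0$, $r,\mu\in\mathbb R$, $\sigma>0$ with $\gamma:=(\mu-r)/\sigma>0$, and let $(W_t)_{t\in[0,T]}$ be a one-dimensional Wiener process on a filtered probability space $(\Omega,\mathcal F,(\mathcal F_t),\mathbb Q)$. Put $\tilde Z_T=\exp\big(-(r+\tfrac12\gamma^2)T-\gamma W_T\big)$. Let $v_0>0$, $m\in[0,1]$, $\alpha\in(0,1]$, $c\in[0,1]$ with $c<1+m$, and let $b\in(0,1)\cup(1,\infty)$ and $a\in\mathbb R$ satisfy $a\ge v_0(c-m)$ if $b<1$ and $a>v_0(c-m)$ if $b>1$. If the terminal value of the fund is $v\ge 0$, the manager receives $$M(v)=\begin{cases}v_0(m-c), & v-mv_0<(1-c)v_0,\\ v-v_0, & (1-c)v_0\le v-mv_0<v_0,\\ mv_0+\alpha(v-(1+m)v_0), & v-mv_0\ge v_0,\end{cases}$$ and her utility is $U_M(v)=\frac{1}{1-b}\,(M(v)+a)^{1-b}$. She maximizes $\mathbb E[U_M(V_T)]$ over all $\mathcal F_T$-measurable $V_T\ge 0$ with $\mathbb E[\tilde Z_TV_T]\le v_0$. If $V_T^*$ is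 a maximizer, let $\phi_M(m,\alpha,c)=\mathbb E[U_M(V_T^*)]$ be the manager's value function. Let $x=mv_0+a\ge 0$, $k=v_0(m-c)+a\ge 0$ and $H=\dfrac{x^{1-b}-k^{1-b}}{(1-b)(1+m)v_0}$. **Case A**: $H<\alpha x^{-b}$; **Case B**: $\alpha x^{-b}\le H\le x^{-b}$; **Case C**: $x^{-b}<H$ (with $0^{-b}=+\infty$). Let $\Phi$ be the standard normal distribution function, $$\xi_1=\exp\Big(\tfrac{1-b}{b}\big(r+\tfrac12\gamma^2\big)T+\tfrac{(b-1)^2}{2b^2}\gamma^2T\Big),\quad d(q)=\frac{\log q-(r+\frac12\gamma^2)T}{\gamma\sqrt T},\quad \delta=(1-b^{-1})\gamma\sqrt T,$$ and, for $y,z>0$, $I_y(z)=\alpha^{1/b-1}(yz)^{-1/b}+(1+m-\alpha^{-1}m)v_0-\alpha^{-1}a$. **Proposition.** In each of the three cases the number $\theta$ (in Cases A and C) and then the number $y^*>0$ described below exist and are unique, the random variable $V_T^*$ below is a maximizer with $U_M(V_T^*)$ integrable, and $\phi_M(m,\alpha,c)$, which is the same for every maximizer, has the following value. In each case $y^*$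 is the unique $y>0$ such that $\mathbb E[\tilde Z_TV_T^*]=v_0$ when $y^*$ is replaced by $y$ in the formula for $V_T^*$. *Case A.* $\theta$ is the unique solution $v\in((1+m)v_0,\infty)$ of $$(\alpha v+(m-\alpha(1+m))v_0+a)^{-b}\,(b\alpha v+(m-\alpha(1+m))v_0+a)=k^{1-b},$$ $s=\alpha(\alpha\theta+(m-\alpha(1+m))v_0+a)^{-b}$, $V_T^*=I_{y^*}(\tilde Z_T)\mathbf 1_{\{0<\tilde Z_T\le s/y^*\}}$, and with $d_2=d(y^*/s)$ $$\phi_M=U_M(0)\Phi(d_2)+\tfrac{1}{1-b}(y^*)^{\frac{b-1}{b}}\alpha^{\frac{1-b}{b}}\xi_1\,\big(1-\Phi(d_2+\delta)\big).$$ *Case B.* $V_T^*=I_{y^*}(\tilde Z_T)\mathbf 1_{\{0<\tilde Z_T<\alpha x^{-b}/y^*\}}+(1+m)v_0\mathbf 1_{\{\alpha x^{-b}/y^*\le\tilde Z_T\le H/y^*\}}$, and with $d_2=d(y^*\alpha^{-1}x^{b})$, $d_3=d(y^*/H)$ $$\phi_M=U_M(0)\Phi(d_3)+\tfrac{1}{1-b}(y^*)^{\frac{b-1}{b}}\alpha^{\frac{1-b}{b}}\xi_1\big(1-\Phi(d_2+\delta)\big)+\tfrac{1}{1-b}x^{1-b}\big(\Phi(d_2)-\Phi(d_3)\big).$$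 *Case C.* $\theta$ is the unique solution $v\in((1+m-c)v_0,(1+m)v_0)$ of $(v-v_0+a)^{-b}(bv-v_0+a)=k^{1-b}$, $s=(\theta-v_0+a)^{-b}$, $$V_T^*=I_{y^*}(\tilde Z_T)\mathbf 1_{\{0<\tilde Z_T<\alpha x^{-b}/y^*\}}+(1+m)v_0\mathbf 1_{\{\alpha x^{-b}/y^*\le\tilde Z_T\le x^{-b}/y^*\}}+\big((y^*\tilde Z_T)^{-1/b}+v_0-a\big)\mathbf 1_{\{x^{-b}/y^*<\tilde Z_T\le s/y^*\}},$$ and with $d_2=d(y^*\alpha^{-1}x^{b})$, $d_3=d(y^*x^{b})$, $d_4=d(y^*/s)$ $$\begin{aligned}\phi_M={}&U_M(0)\Phi(d_4)+\tfrac{1}{1-b}(y^*)^{\frac{b-1}{b}}\alpha^{\frac{1-b}{b}}\xi_1\big(1-\Phi(d_2+\delta)\big)+\tfrac{1}{1-b}x^{1-b}\big(\Phi(d_2)-\Phi(d_3)\big)\\&+\tfrac{1}{1-b}(y^*)^{\frac{b-1}{b}}\xi_1\big(\Phi(d_3+\delta)-\Phi(d_4+\delta)\big).\end{aligned}$$ 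-/

import Mathlib

open MeasureTheory ProbabilityTheory
open scoped NNReal ENNReal

noncomputable section

namespace FirstLoss

/-- `W` is a Wiener process on `[0, T]` with respect to the filtration `ℱ` (only the values at
times `t ≤ T` matter). -/
structure IsWiener {Ω : Type*} {mΩ : MeasurableSpace Ω} (Q : Measure Ω)
    (ℱ : Filtration ℝ≥0 mΩ) (T : ℝ≥0) (W : ℝ≥0 → Ω → ℝ) : Prop where
  adapted : ∀ t ≤ T, Measurable[ℱ t] (W t)
  start_zero : ∀ᵐ ω ∂Q, W 0 ω = 0
  increment_law : ∀ s t : ℝ≥0, s ≤ t → t ≤ T →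
    HasLaw (fun ω => W t ω - W s ω) (gaussianReal 0 (t - s)) Q
  increment_indep : ∀ s t : ℝ≥0, s ≤ t → t ≤ T →
    Indep (MeasurableSpace.comap (fun ω => W t ω - W s ω) inferInstance) (ℱ s) Q
  continuous_paths : ∀ᵐ ω ∂Q, ContinuousOn (fun t => W t ω) (Set.Icc 0 T)

/-- The parameters of the market, of the fund and of the manager:
horizon `T`, interest rate `r`, drift `μ`, volatility `σ`, initial fund value `v₀`,
management fee `m`, performance fee `α`, first-loss coverage guarantee `c`,
and the HARA parameters `a`, `b` of the manager. -/
structure Model where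
  T : ℝ≥0
  r : ℝ
  μ : ℝ
  σ : ℝ
  v₀ : ℝ
  m : ℝ
  α : ℝ
  c : ℝ
  a : ℝ
  b : ℝ

namespace Model

variable (p : Model)

/-- The standing assumptions on the parameters. -/
structure Admissible : Prop where
  T_pos : 0 < p.T
  σ_pos : 0 < p.σ
  /-- the market price of risk is positive -/
  r_lt_μ : p.r < p.μ
  v₀_pos : 0 < p.v₀
  m_mem : p.m ∈ Set.Icc (0 : ℝ) 1
  α_mem : p.α ∈ Set.Ioc (0 : ℝ) 1
  c_mem : p.c ∈ Set.Icc (0 : ℝ) 1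
  /-- the flat part `[0, (1 + m - c) v₀)` of the manager's payoff is not empty -/
  c_lt : p.c < 1 + p.m
  b_pos : 0 < p.b
  b_ne_one : p.b ≠ 1
  /-- the utility of the manager's minimal terminal wealth `(m - c) v₀` is finite -/
  a_ge : p.b < 1 → p.v₀ * (p.c - p.m) ≤ p.a
  a_gt : 1 < p.b → p.v₀ * (p.c - p.m) < p.a

/-- The market price of risk. -/
def γ : ℝ := (p.μ - p.r) / p.σ

/-- The state price density at time `t`, as a function of the value of `W t`. -/
def spd {Ω : Type*} (W : ℝ≥0 → Ω → ℝ) (t : ℝ≥0) (ω : Ω) : ℝ :=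
  Real.exp (-(p.r + p.γ ^ 2 / 2) * t - p.γ * W t ω)

/-! ### The manager's payoff and utility -/

/-- The manager's terminal wealth `M(v)` when the terminal value of the fund is `v`. -/
def payoff (v : ℝ) : ℝ :=
  if v - p.m * p.v₀ < (1 - p.c) * p.v₀ then p.v₀ * (p.m - p.c)
  else if v - p.m * p.v₀ < p.v₀ then v - p.v₀
  else p.m * p.v₀ + p.α * (v - (1 + p.m) * p.v₀)

/-- The HARA utility function of the manager's wealth. -/
def hara (x : ℝ) : ℝ := 1 / (1 - p.b) * (x + p.a) ^ (1 - p.b)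

/-- The manager's utility `U_M(v)` as a function of the terminal value `v ≥ 0` of the fund. -/
def utility (v : ℝ) : ℝ := p.hara (p.payoff v)

/-! ### The terminal value problem
Maximize `E[U_M(V)]` over terminal values `V ≥ 0` with `E[Z_T V] ≤ v₀`. -/

section Problem

variable {Ω : Type*} {mΩ : MeasurableSpace Ω} (Q : Measure Ω) (ℱ : Filtration ℝ≥0 mΩ)
  (W : ℝ≥0 → Ω → ℝ)

/-- Feasible terminal values; `E[Z_T V]` is an integral of a nonnegative function, possibly `∞`. -/
structure Feasible (V : Ω → ℝ) : Prop where
  measurable : Measurable[ℱ p.T] V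
  nonneg : ∀ᵐ ω ∂Q, 0 ≤ V ω
  budget : ∫⁻ ω, ENNReal.ofReal (p.spd W p.T ω * V ω) ∂Q ≤ ENNReal.ofReal p.v₀

/-- `V` is an optimal terminal value. The function `U_M` is bounded below, so `E[U_M(V')]` is
always a well-defined element of `(-∞, ∞]`, and it is finite exactly if `U_M(V')` is integrable;
thus the last clause says that `E[U_M(V')] ≤ E[U_M(V)] < ∞` for every feasible `V'`. -/
structure IsOptimal (V : Ω → ℝ) : Prop where
  feasible : p.Feasible Q ℱ W V
  integrable : Integrable (fun ω => p.utility (V ω)) Q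
  maximal : ∀ V' : Ω → ℝ, p.Feasible Q ℱ W V' →
    Integrable (fun ω => p.utility (V' ω)) Q ∧
      ∫ ω, p.utility (V' ω) ∂Q ≤ ∫ ω, p.utility (V ω) ∂Q

/-- `y > 0` solves `E[Z_T v(y, Z_T)] = v₀`. -/
def IsMultiplier (v : ℝ → ℝ → ℝ) (y : ℝ) : Prop :=
  0 < y ∧ ∫ ω, p.spd W p.T ω * v y (p.spd W p.T ω) ∂Q = p.v₀

end Problem

/-! ### The three cases -/

/-- The manager's shifted wealth `m v₀ + a` at the fund value `(1 + m) v₀`. -/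
def x₂ : ℝ := p.m * p.v₀ + p.a

/-- The slope of the chord of `U_M` between `0` and `(1 + m) v₀`. -/
def H : ℝ :=
  (p.x₂ ^ (1 - p.b) - (p.v₀ * (p.m - p.c) + p.a) ^ (1 - p.b)) / ((1 - p.b) * (1 + p.m) * p.v₀)

/-- `H < α (m v₀ + a)^{-b}`. In this and in the next two definitions the inequalities are
multiplied by `(m v₀ + a)^b`. This is an equivalence if `m v₀ + a > 0`; the only other
possibility is `m v₀ + a = 0` (and then `b < 1`, `c = 0`, `H = 0`), where `(m v₀ + a)^{-b}` means
`+∞`, so that the parameters belong to Case A. -/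
def CaseA : Prop := p.H * p.x₂ ^ p.b < p.α

/-- `α (m v₀ + a)^{-b} ≤ H ≤ (m v₀ + a)^{-b}`. -/
def CaseB : Prop := p.α ≤ p.H * p.x₂ ^ p.b ∧ p.H * p.x₂ ^ p.b ≤ 1

/-- `(m v₀ + a)^{-b} < H`. -/
def CaseC : Prop := 1 < p.H * p.x₂ ^ p.b

/-- `θ` solves the equation of the concavification point in Case A. -/
def IsThetaA (θ : ℝ) : Prop :=
  (1 + p.m) * p.v₀ < θ ∧
  (p.α * θ + (p.m - p.α * (1 + p.m)) * p.v₀ + p.a) ^ (-p.b) *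
      (p.b * p.α * θ + (p.m - p.α * (1 + p.m)) * p.v₀ + p.a) =
    (p.v₀ * (p.m - p.c) + p.a) ^ (1 - p.b)

/-- `θ` solves the equation of the concavification point in Case C. -/
def IsThetaC (θ : ℝ) : Prop :=
  (1 + p.m - p.c) * p.v₀ < θ ∧ θ < (1 + p.m) * p.v₀ ∧
  (θ - p.v₀ + p.a) ^ (-p.b) * (p.b * θ - p.v₀ + p.a) =
    (p.v₀ * (p.m - p.c) + p.a) ^ (1 - p.b)

/-- The slope `s(θ)` in Case A. -/
def slopeA (θ : ℝ) : ℝ :=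
  p.α * (p.α * θ + (p.m - p.α * (1 + p.m)) * p.v₀ + p.a) ^ (-p.b)

/-- The slope `s(θ)` in Case B, where `θ = (1 + m) v₀`. -/
def slopeB : ℝ := p.H

/-- The slope `s(θ)` in Case C. -/
def slopeC (θ : ℝ) : ℝ := (θ - p.v₀ + p.a) ^ (-p.b)

/-! ### The optimal terminal values as functions of `y` and of the value `z > 0` of `Z_T` -/

/-- `α^{1/b-1} (y z)^{-1/b} + (1 + m - α⁻¹ m) v₀ - α⁻¹ a`. -/
def upper (y z : ℝ) : ℝ :=
  p.α ^ (1 / p.b - 1) * (y * z) ^ (-1 / p.b) + (1 + p.m - p.α⁻¹ * p.m) * p.v₀ - p.α⁻¹ * p.a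

/-- Case A. -/
def fundA (θ y z : ℝ) : ℝ :=
  (Set.Ioc 0 (p.slopeA θ / y)).indicator (p.upper y) z

/-- Case B. -/
def fundB (y z : ℝ) : ℝ :=
  (Set.Ioo 0 (p.α * p.x₂ ^ (-p.b) / y)).indicator (p.upper y) z +
  (Set.Icc (p.α * p.x₂ ^ (-p.b) / y) (p.slopeB / y)).indicator
    (fun _ => (1 + p.m) * p.v₀) z

/-- Case C. -/
def fundC (θ y z : ℝ) : ℝ :=
  (Set.Ioo 0 (p.α * p.x₂ ^ (-p.b) / y)).indicator (p.upper y) z +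
  (Set.Icc (p.α * p.x₂ ^ (-p.b) / y) (p.x₂ ^ (-p.b) / y)).indicator
    (fun _ => (1 + p.m) * p.v₀) z +
  (Set.Ioc (p.x₂ ^ (-p.b) / y) (p.slopeC θ / y)).indicator
    (fun z => (y * z) ^ (-1 / p.b) + p.v₀ - p.a) z

/-! ### The closed formulas -/

/-- The standard normal distribution function. -/
def Φ (x : ℝ) : ℝ := cdf (gaussianReal 0 1) x

/-- The constant `ξ₁`. -/
def ξ₁ : ℝ :=
  Real.exp ((1 - p.b) * p.b⁻¹ * (p.r + p.γ ^ 2 / 2) * p.T +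
    (p.b - 1) ^ 2 * (p.b⁻¹) ^ 2 / 2 * p.γ ^ 2 * p.T)

/-- `(log x - (r + γ²/2) T) / (γ √T)`. -/
def d (x : ℝ) : ℝ :=
  (Real.log x - (p.r + p.γ ^ 2 / 2) * p.T) / (p.γ * Real.sqrt p.T)

/-- The shift `(1 - b⁻¹) γ √T` of the arguments. -/
def shift : ℝ := (1 - p.b⁻¹) * p.γ * Real.sqrt p.T

def dA₂ (θ y : ℝ) : ℝ := p.d (y / p.slopeA θ)
def dB₂ (y : ℝ) : ℝ := p.d (y * p.α⁻¹ * p.x₂ ^ p.b)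
def dB₃ (y : ℝ) : ℝ := p.d (y / p.slopeB)
def dC₂ (y : ℝ) : ℝ := p.d (y * p.α⁻¹ * p.x₂ ^ p.b)
def dC₃ (y : ℝ) : ℝ := p.d (y * p.x₂ ^ p.b)
def dC₄ (θ y : ℝ) : ℝ := p.d (y / p.slopeC θ)

/-- The formula in Case A. Here and below `d₁ = +∞`, so that `Φ(d₁ + shift) = 1`. -/
def valueA (θ y : ℝ) : ℝ :=
  p.utility 0 * Φ (p.dA₂ θ y) +
  (1 - p.b)⁻¹ * y ^ ((p.b - 1) / p.b) * p.α ^ ((1 - p.b) / p.b) * p.ξ₁ *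
    (1 - Φ (p.dA₂ θ y + p.shift))

/-- The formula in Case B. -/
def valueB (y : ℝ) : ℝ :=
  p.utility 0 * Φ (p.dB₃ y) +
  (1 - p.b)⁻¹ * y ^ ((p.b - 1) / p.b) * p.α ^ ((1 - p.b) / p.b) * p.ξ₁ *
    (1 - Φ (p.dB₂ y + p.shift)) +
  (1 - p.b)⁻¹ * p.x₂ ^ (1 - p.b) * (Φ (p.dB₂ y) - Φ (p.dB₃ y))

/-- The formula in Case C. -/
def valueC (θ y : ℝ) : ℝ :=
  p.utility 0 * Φ (p.dC₄ θ y) +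
  (1 - p.b)⁻¹ * y ^ ((p.b - 1) / p.b) * p.α ^ ((1 - p.b) / p.b) * p.ξ₁ *
    (1 - Φ (p.dC₂ y + p.shift)) +
  (1 - p.b)⁻¹ * p.x₂ ^ (1 - p.b) * (Φ (p.dC₂ y) - Φ (p.dC₃ y)) +
  (1 - p.b)⁻¹ * y ^ ((p.b - 1) / p.b) * p.ξ₁ *
    (Φ (p.dC₃ y + p.shift) - Φ (p.dC₄ θ y + p.shift))

end Model

end FirstLoss

end

noncomputable section

/-! The proof is Lagrangian duality combined with concavification. Above `floor` the shifted payoff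
is the minimum of two affine functions, because `α ≤ 1`, so the utility is concave there with a kink
at `(1 + m) v₀`; below `floor` it is constant. At a price `l = y z` the maximizer of `U_M(v) - l v`
over `v ≥ 0` is therefore either `0` or the point `level (l ^ (-1 / b))` at which `l` is a
supergradient of the concave part. The switch occurs at the slope `s` of the line through `(0,
U_M(0))` that supports the concave part. This is `IsEnvelopeSlope`, and `utility_sub_le_policy` is
the resulting pointwise optimality.

The three cases say where this line touches the graph: to the right of the kink (A), at the kink
(B), or between `floor` and the kink (C). In A and C the contact point is a zero of `tangentGap`,
found by the intermediate value theorem. It is unique because the envelope slope is unique and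
determines the contact point.

The cost of the policy is continuous and strictly decreasing in `y`, unbounded as `y` decreases to
`0`, with limit `0` at infinity, so exactly one multiplier exhausts the budget (`exists_cost_eq`,
`cost_strictAntiOn`). Integrating the pointwise inequality at this multiplier gives optimality
(`isOptimal_policy`).

For the value, the state price density is a decreasing exponential of a standard normal variable.
The regions of the policy become intervals, and on each of them the utility is a constant or a
multiple of a power of the density, which exponential tilting evaluates. -/

namespace FirstLoss

/-! ### Tangent and monotonicity bounds for the power utility. -/

/-- The power utility function lies below its tangents. -/
theorem powerUtility_le_tangent {b w w₀ : ℝ} (hb : 0 < b) (hb1 : b ≠ 1) (hw₀ : 0 < w₀)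
    (hw : 0 ≤ w) (hw' : 1 < b → 0 < w) :
    1 / (1 - b) * w ^ (1 - b) ≤ 1 / (1 - b) * w₀ ^ (1 - b) + w₀ ^ (-b) * (w - w₀) := by
  obtain ⟨t, rfl⟩ : ∃ t, w = w₀ * t := ⟨w / w₀, by field_simp⟩
  have ht : 0 ≤ t := nonneg_of_mul_nonneg_right hw hw₀
  have h0 : w₀ ^ (-b) * w₀ = w₀ ^ (1 - b) := by
    rw [← Real.rpow_add_one hw₀.ne']; ring_nf
  -- By homogeneity the claim reduces to `w₀ = 1`, which is a form of Bernoulli's inequality.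
  have key : 1 / (1 - b) * t ^ (1 - b) ≤ 1 / (1 - b) + (t - 1) := by
    rcases lt_or_gt_of_ne hb1 with h | h
    · have := rpow_one_add_le_one_add_mul_self (s := t - 1) (by linarith)
        (p := 1 - b) (by linarith) (by linarith)
      have h1 : 0 < 1 - b := by linarith
      rw [add_sub_cancel] at this
      calc 1 / (1 - b) * t ^ (1 - b) ≤ 1 / (1 - b) * (1 + (1 - b) * (t - 1)) := by gcongr
        _ = _ := by field_simp
    · have htp : 0 < t := pos_of_mul_pos_right (hw' h) hw₀.le
      -- Now `1 - b` is negative. Bernoulli with the exponent `b > 1` is applied at `t⁻¹`;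
      -- multiplying by `t` yields the lower bound for `t ^ (1 - b)`.
      have := one_add_mul_self_le_rpow_one_add (s := t⁻¹ - 1)
        (by linarith [inv_pos.2 htp]) h.le
      rw [add_sub_cancel, Real.inv_rpow ht, ← Real.rpow_neg ht] at this
      have h3 : t ^ (-b) * t = t ^ (1 - b) := by
        rw [← Real.rpow_add_one htp.ne']; ring_nf
      have h4 : 1 + (1 - b) * (t - 1) ≤ t ^ (1 - b) := by
        calc 1 + (1 - b) * (t - 1) = (1 + b * (t⁻¹ - 1)) * t := by field_simp; ring
          _ ≤ t ^ (-b) * t := by gcongr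
          _ = _ := h3
      have h1 : 1 / (1 - b) < 0 := one_div_neg.2 (by linarith)
      calc 1 / (1 - b) * t ^ (1 - b) ≤ 1 / (1 - b) * (1 + (1 - b) * (t - 1)) :=
            mul_le_mul_of_nonpos_left h4 h1.le
        _ = _ := by
          have : 1 - b ≠ 0 := by linarith
          field_simp
  rw [Real.mul_rpow hw₀.le ht]
  have h5 : 0 < w₀ ^ (1 - b) := Real.rpow_pos_of_pos hw₀ _
  calc 1 / (1 - b) * (w₀ ^ (1 - b) * t ^ (1 - b))
      = w₀ ^ (1 - b) * (1 / (1 - b) * t ^ (1 - b)) := by ring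
    _ ≤ w₀ ^ (1 - b) * (1 / (1 - b) + (t - 1)) := by gcongr
    _ = _ := by rw [← h0]; ring

theorem powerUtility_mono {b w w₀ : ℝ} (hb1 : b ≠ 1)
    (hw₀ : 0 ≤ w₀) (hw' : 1 < b → 0 < w₀) (h : w₀ ≤ w) :
    1 / (1 - b) * w₀ ^ (1 - b) ≤ 1 / (1 - b) * w ^ (1 - b) := by
  rcases lt_or_gt_of_ne hb1 with hb | hb
  · have : 0 < 1 - b := by linarith
    gcongr
  · exact mul_le_mul_of_nonpos_left (Real.rpow_le_rpow_of_nonpos (hw' hb) h (by linarith))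
      (one_div_neg.2 (by linarith)).le

/-! ### The manager's payoff and utility as functions of the fund value. -/

namespace Model

variable {p : Model}

/-- The manager's shifted wealth `(m - c) v₀ + a` at the fund value `0`. -/
def x₀ (p : Model) : ℝ := p.v₀ * (p.m - p.c) + p.a

/-- The fund value above which the payoff of the manager starts to increase. -/
def floor (p : Model) : ℝ := (1 + p.m - p.c) * p.v₀

namespace Admissible

theorem x₀_nonneg (hp : p.Admissible) : 0 ≤ p.x₀ := by
  rcases lt_or_gt_of_ne hp.b_ne_one with h | h
  · have := hp.a_ge h; unfold x₀; linarith
  · have := hp.a_gt h; unfold x₀; linarith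

theorem x₀_pos (hp : p.Admissible) (h : 1 < p.b) : 0 < p.x₀ := by
  have := hp.a_gt h; unfold x₀; linarith

theorem x₂_eq (p : Model) : p.x₂ = p.x₀ + p.c * p.v₀ := by
  unfold x₂ x₀; ring

theorem x₀_le_x₂ (hp : p.Admissible) : p.x₀ ≤ p.x₂ := by
  rw [x₂_eq]; have := mul_nonneg hp.c_mem.1 hp.v₀_pos.le; linarith

theorem x₂_nonneg (hp : p.Admissible) : 0 ≤ p.x₂ := hp.x₀_nonneg.trans hp.x₀_le_x₂

theorem α_pos (hp : p.Admissible) : 0 < p.α := hp.α_mem.1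

theorem floor_pos (hp : p.Admissible) : 0 < p.floor :=
  mul_pos (by linarith [hp.c_lt]) hp.v₀_pos

theorem top_pos (hp : p.Admissible) : 0 < (1 + p.m) * p.v₀ :=
  mul_pos (by linarith [hp.m_mem.1]) hp.v₀_pos

theorem floor_eq (p : Model) : p.floor = (1 + p.m) * p.v₀ - p.c * p.v₀ := by
  unfold floor; ring

theorem floor_le_top (hp : p.Admissible) : p.floor ≤ (1 + p.m) * p.v₀ := by
  rw [floor_eq]; have := mul_nonneg hp.c_mem.1 hp.v₀_pos.le; linarith

theorem γ_pos (hp : p.Admissible) : 0 < p.γ := div_pos (by linarith [hp.r_lt_μ]) hp.σ_pos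

end Admissible

theorem payoff_add_of_lt_floor {v : ℝ} (hv : v < p.floor) : p.payoff v + p.a = p.x₀ := by
  have : v - p.m * p.v₀ < (1 - p.c) * p.v₀ := by
    unfold floor at hv; linarith
  rw [payoff, if_pos this, x₀]

/-- The slope drops from `1` to `α ≤ 1` at `(1 + m) v₀`, so both branches combine into a minimum.
This exhibits concavity above `floor` and lets one tangent estimate cover both branches. -/
theorem payoff_add_of_floor_le (hp : p.Admissible) {v : ℝ} (hv : p.floor ≤ v) :
    p.payoff v + p.a =
      p.x₂ + min (v - (1 + p.m) * p.v₀) (p.α * (v - (1 + p.m) * p.v₀)) := by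
  have h1 : ¬ (v - p.m * p.v₀ < (1 - p.c) * p.v₀) := by
    unfold floor at hv; push Not; linarith
  have hα := hp.α_mem.2
  have hα0 := hp.α_pos
  rw [payoff, if_neg h1]
  split_ifs with h2
  · rw [min_eq_left (by nlinarith), x₂]; ring
  · rw [min_eq_right (by nlinarith), x₂]; ring

theorem x₀_le_payoff_add (hp : p.Admissible) (v : ℝ) : p.x₀ ≤ p.payoff v + p.a := by
  rcases lt_or_ge v p.floor with hv | hv
  · rw [payoff_add_of_lt_floor hv]
  · rw [payoff_add_of_floor_le hp hv, Admissible.x₂_eq]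
    have h1 : -(p.c * p.v₀) ≤ v - (1 + p.m) * p.v₀ := by
      rw [Admissible.floor_eq] at hv; linarith
    have hc := mul_nonneg hp.c_mem.1 hp.v₀_pos.le
    have hα := hp.α_mem.2
    have hα0 := hp.α_pos
    have : -(p.c * p.v₀) ≤ min (v - (1 + p.m) * p.v₀) (p.α * (v - (1 + p.m) * p.v₀)) :=
      le_min h1 (by nlinarith)
    linarith

theorem utility_of_lt_floor {v : ℝ} (hv : v < p.floor) :
    p.utility v = 1 / (1 - p.b) * p.x₀ ^ (1 - p.b) := by
  rw [utility, hara, payoff_add_of_lt_floor hv]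

theorem utility_zero (hp : p.Admissible) :
    p.utility 0 = 1 / (1 - p.b) * p.x₀ ^ (1 - p.b) := utility_of_lt_floor hp.floor_pos

theorem utility_zero_le (hp : p.Admissible) (v : ℝ) : p.utility 0 ≤ p.utility v := by
  rw [utility_zero hp]
  exact powerUtility_mono hp.b_ne_one hp.x₀_nonneg hp.x₀_pos (x₀_le_payoff_add hp v)

theorem utility_of_top_le (hp : p.Admissible) {v : ℝ} (hv : (1 + p.m) * p.v₀ ≤ v) :
    p.utility v =
      1 / (1 - p.b) * (p.x₂ + p.α * (v - (1 + p.m) * p.v₀)) ^ (1 - p.b) := by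
  have hα := hp.α_mem.2
  rw [utility, hara, payoff_add_of_floor_le hp (hp.floor_le_top.trans hv),
    min_eq_right (by nlinarith)]

theorem utility_of_le_top (hp : p.Admissible) {v : ℝ} (hv : p.floor ≤ v)
    (hv' : v ≤ (1 + p.m) * p.v₀) :
    p.utility v = 1 / (1 - p.b) * (p.x₂ + (v - (1 + p.m) * p.v₀)) ^ (1 - p.b) := by
  have hα := hp.α_mem.2
  rw [utility, hara, payoff_add_of_floor_le hp hv, min_eq_left (by nlinarith)]

/-- A tangent of the power utility bounds the utility of the manager. -/
theorem utility_le_tangent (hp : p.Admissible) {v w₀ : ℝ} (hw₀ : 0 < w₀) (hv : p.floor ≤ v) :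
    p.utility v ≤ 1 / (1 - p.b) * w₀ ^ (1 - p.b) + w₀ ^ (-p.b) *
      (p.x₂ + min (v - (1 + p.m) * p.v₀) (p.α * (v - (1 + p.m) * p.v₀)) - w₀) := by
  have h := x₀_le_payoff_add hp v
  rw [← payoff_add_of_floor_le hp hv]
  exact powerUtility_le_tangent hp.b_pos hp.b_ne_one hw₀ (hp.x₀_nonneg.trans h)
    fun hb => (hp.x₀_pos hb).trans_le h

/-! ### Pointwise maximization on the concave part of the utility. -/

/-- The fund value at which the manager's shifted wealth is optimal among the fund values above
`floor`, as a function of `ℓ = (y z)^{-1/b}`. -/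
def level (p : Model) (ℓ : ℝ) : ℝ :=
  (1 + p.m) * p.v₀ + max ((p.α ^ (1 / p.b) * ℓ - p.x₂) / p.α) (min 0 (ℓ - p.x₂))

theorem level_monotone (hp : p.Admissible) : Monotone p.level := by
  intro ℓ ℓ' h
  have hα := hp.α_pos
  have : 0 < p.α ^ (1 / p.b) := Real.rpow_pos_of_pos hα _
  unfold level
  gcongr

theorem continuous_level : Continuous p.level := by
  unfold level
  fun_prop

theorem level_of_upper {ℓ : ℝ} (hp : p.Admissible) (h : p.x₂ ≤ p.α ^ (1 / p.b) * ℓ) :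
    p.level ℓ = (1 + p.m) * p.v₀ + (p.α ^ (1 / p.b) * ℓ - p.x₂) / p.α := by
  rw [level, max_eq_left]
  exact (min_le_left _ _).trans (div_nonneg (by linarith) hp.α_pos.le)

theorem level_of_kink {ℓ : ℝ} (hp : p.Admissible) (h : p.α ^ (1 / p.b) * ℓ ≤ p.x₂)
    (h' : p.x₂ ≤ ℓ) : p.level ℓ = (1 + p.m) * p.v₀ := by
  rw [level, min_eq_left (by linarith), max_eq_right, add_zero]
  exact div_nonpos_of_nonpos_of_nonneg (by linarith) hp.α_pos.le

theorem α_rpow_le_one (hp : p.Admissible) : p.α ^ (1 / p.b) ≤ 1 :=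
  Real.rpow_le_one hp.α_pos.le hp.α_mem.2 (by have := hp.b_pos; positivity)

theorem level_of_lower {ℓ : ℝ} (hp : p.Admissible) (hℓ : 0 ≤ ℓ) (h : ℓ ≤ p.x₂) :
    p.level ℓ = (1 + p.m) * p.v₀ + (ℓ - p.x₂) := by
  rw [level, min_eq_right (by linarith), max_eq_right]
  rw [div_le_iff₀ hp.α_pos]
  nlinarith [α_rpow_le_one hp, hp.α_mem.2]

theorem rpow_neg_one_div_rpow (hp : p.Admissible) {l : ℝ} (hl : 0 < l) :
    (l ^ (-1 / p.b)) ^ (-p.b) = l := by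
  have := hp.b_pos
  rw [← Real.rpow_mul hl.le, show -1 / p.b * -p.b = 1 by field_simp, Real.rpow_one]

theorem α_rpow_mul_rpow (hp : p.Admissible) {l : ℝ} (hl : 0 < l) :
    (p.α ^ (1 / p.b) * l ^ (-1 / p.b)) ^ (-p.b) = l / p.α := by
  have := hp.b_pos
  rw [Real.mul_rpow (Real.rpow_nonneg hp.α_pos.le _) (Real.rpow_nonneg hl.le _),
    rpow_neg_one_div_rpow hp hl, ← Real.rpow_mul hp.α_pos.le,
    show 1 / p.b * -p.b = -1 by field_simp, Real.rpow_neg_one]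
  ring

/-- Above `floor` the fund value `level` is optimal at the price `l`. -/
theorem utility_sub_le_level (hp : p.Admissible) {l v : ℝ} (hl : 0 < l)
    (hlev : p.floor ≤ p.level (l ^ (-1 / p.b))) (hv : p.floor ≤ v) :
    p.utility v - l * v ≤
      p.utility (p.level (l ^ (-1 / p.b))) - l * p.level (l ^ (-1 / p.b)) := by
  set ℓ := l ^ (-1 / p.b) with hℓ
  have hℓ0 : 0 < ℓ := Real.rpow_pos_of_pos hl _
  have hα := hp.α_pos
  have hw := Real.rpow_pos_of_pos hα (1 / p.b)
  set t := v - (1 + p.m) * p.v₀ with ht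
  have hvt : v = (1 + p.m) * p.v₀ + t := by rw [ht]; ring
  have hα1 := hp.α_mem.2
  rcases le_total p.x₂ (p.α ^ (1 / p.b) * ℓ) with h1 | h1
  · have hE := level_of_upper hp h1
    have h2 := utility_le_tangent hp (mul_pos hw hℓ0) hv
    rw [hℓ, α_rpow_mul_rpow hp hl, ← hℓ, ← ht] at h2
    rw [utility_of_top_le hp (v := p.level ℓ)
      (by rw [hE]; linarith [div_nonneg (sub_nonneg.2 h1) hα.le]), hE, add_sub_cancel_left,
      mul_div_cancel₀ _ hα.ne', add_sub_cancel]
    have h3 : l / p.α * (p.x₂ + min t (p.α * t) - p.α ^ (1 / p.b) * ℓ) ≤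
        l / p.α * (p.x₂ + p.α * t - p.α ^ (1 / p.b) * ℓ) := by
      gcongr; exact min_le_right _ _
    have h4 : l / p.α * (p.x₂ + p.α * t - p.α ^ (1 / p.b) * ℓ) =
      l * (t - (p.α ^ (1 / p.b) * ℓ - p.x₂) / p.α) := by field_simp; ring
    have hlv : l * v = l * ((1 + p.m) * p.v₀ + t) := by rw [← hvt]
    linarith
  rcases le_total p.x₂ ℓ with h2 | h2
  -- At the kink the price lies between the one-sided slopes `α x₂ ^ (-b)` and `x₂ ^ (-b)`; the sign
  -- of `t` decides which of the two bounds is needed.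
  · have hx : 0 < p.x₂ := (mul_pos hw hℓ0).trans_le h1
    have hE := level_of_kink hp h1 h2
    have h3 := utility_le_tangent hp hx hv
    rw [utility_of_top_le hp (v := p.level ℓ) hE.ge, hE, sub_self, mul_zero, add_zero]
    have h4 : l ≤ p.x₂ ^ (-p.b) := by
      rw [← rpow_neg_one_div_rpow hp hl, ← hℓ]
      exact Real.rpow_le_rpow_of_nonpos hx h2 (by linarith [hp.b_pos])
    have h5 : p.x₂ ^ (-p.b) * p.α ≤ l := by
      rw [← le_div_iff₀ hα, ← α_rpow_mul_rpow hp hl, ← hℓ]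
      exact Real.rpow_le_rpow_of_nonpos (mul_pos hw hℓ0) h1 (by linarith [hp.b_pos])
    rw [← ht, add_sub_cancel_left] at h3
    have h6 : p.x₂ ^ (-p.b) * min t (p.α * t) ≤ l * t := by
      have h7 : 0 < p.x₂ ^ (-p.b) := Real.rpow_pos_of_pos hx _
      rcases le_total 0 t with h0 | h0
      · nlinarith [min_le_right t (p.α * t)]
      · nlinarith [min_le_left t (p.α * t)]
    have hlv : l * v = l * ((1 + p.m) * p.v₀ + t) := by rw [← hvt]
    linarith
  · have hE := level_of_lower hp hℓ0.le h2
    have h3 := utility_le_tangent hp hℓ0 hv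
    rw [utility_of_le_top hp hlev (by rw [hE]; linarith), hE, add_sub_cancel_left, add_sub_cancel]
    rw [hℓ, rpow_neg_one_div_rpow hp hl, ← hℓ, ← ht] at h3
    have h4 : l * (p.x₂ + min t (p.α * t) - ℓ) ≤ l * (p.x₂ + t - ℓ) := by
      gcongr; exact min_le_left _ _
    have hlv : l * v = l * ((1 + p.m) * p.v₀ + t) := by rw [← hvt]
    linarith

/-! ### The concave envelope and the pointwise optimal policy. -/

/-- `s` is the slope of the concave envelope of the utility on its initial linear part. -/
structure IsEnvelopeSlope (p : Model) (s : ℝ) : Prop where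
  pos : 0 < s
  floor_le : p.floor ≤ p.level (s ^ (-1 / p.b))
  tangent : p.utility (p.level (s ^ (-1 / p.b))) - s * p.level (s ^ (-1 / p.b)) = p.utility 0

/-- The optimal fund value at the price `l > 0`. -/
def policy (p : Model) (s l : ℝ) : ℝ := if l ≤ s then p.level (l ^ (-1 / p.b)) else 0

theorem rpow_neg_one_div_anti (hp : p.Admissible) {l l' : ℝ} (hl : 0 < l) (h : l ≤ l') :
    l' ^ (-1 / p.b) ≤ l ^ (-1 / p.b) :=
  Real.rpow_le_rpow_of_nonpos hl h
    (div_nonpos_of_nonpos_of_nonneg (by norm_num) hp.b_pos.le)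

theorem floor_le_level (hp : p.Admissible) {s l : ℝ} (hs : p.IsEnvelopeSlope s)
    (hl : 0 < l) (h : l ≤ s) : p.floor ≤ p.level (l ^ (-1 / p.b)) :=
  hs.floor_le.trans (level_monotone hp (rpow_neg_one_div_anti hp hl h))

theorem policy_nonneg (hp : p.Admissible) {s l : ℝ} (hs : p.IsEnvelopeSlope s)
    (hl : 0 < l) : 0 ≤ p.policy s l := by
  unfold policy
  split_ifs with h
  · exact hp.floor_pos.le.trans (floor_le_level hp hs hl h)
  · exact le_rfl

/-- At the price `s` the concave part is maximized at the contact point, where the maximum is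
`U_M(0)` by tangency; on the flat part the bound is trivial. -/
theorem utility_le_chord (hp : p.Admissible) {s v : ℝ} (hs : p.IsEnvelopeSlope s)
    (hv : 0 ≤ v) : p.utility v ≤ p.utility 0 + s * v := by
  rcases lt_or_ge v p.floor with h | h
  · rw [utility_of_lt_floor h, ← utility_zero hp]
    linarith [mul_nonneg hs.pos.le hv]
  · have := utility_sub_le_level hp hs.pos hs.floor_le h
    linarith [hs.tangent]

/-- `policy` maximizes the utility minus the cost. -/
theorem utility_sub_le_policy (hp : p.Admissible) {s l v : ℝ} (hs : p.IsEnvelopeSlope s)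
    (hl : 0 < l) (hv : 0 ≤ v) :
    p.utility v - l * v ≤ p.utility (p.policy s l) - l * p.policy s l := by
  unfold policy
  split_ifs with h
  · have hL := floor_le_level hp hs hl h
    rcases lt_or_ge v p.floor with hvL | hvL
    -- A fund value on the flat part is compared through the contact point of the supporting line:
    -- its utility `U_M(0)` is the net utility there at the price `s`, and lowering the price to `l`
    -- only increases that.
    · have h1 := utility_sub_le_level hp hl hL hs.floor_le
      have h2 := hs.tangent
      have h3 := mul_le_mul_of_nonneg_right h (hp.floor_pos.le.trans hs.floor_le)
      have h4 := mul_nonneg hl.le hv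
      rw [utility_of_lt_floor hvL, ← utility_zero hp]
      linarith
    · exact utility_sub_le_level hp hl hL hvL
  · have := utility_le_chord hp hs hv
    have h3 := mul_le_mul_of_nonneg_right (not_le.1 h).le hv
    linarith

theorem policy_antitone (hp : p.Admissible) {s l l' : ℝ} (hs : p.IsEnvelopeSlope s)
    (hl : 0 < l) (h : l ≤ l') : p.policy s l' ≤ p.policy s l := by
  by_cases h' : l' ≤ s
  · rw [policy, policy, if_pos h', if_pos (h.trans h')]
    exact level_monotone hp (rpow_neg_one_div_anti hp hl h)
  · rw [policy, if_neg h']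
    exact policy_nonneg hp hs hl

/-- The line of slope `s'` majorizes the utility, in particular at the positive contact point of the
line of slope `s`; both lines start at `(0, U_M(0))`. -/
theorem IsEnvelopeSlope.le (hp : p.Admissible) {s s' : ℝ} (hs : p.IsEnvelopeSlope s)
    (hs' : p.IsEnvelopeSlope s') : s ≤ s' := by
  have hpos := hp.floor_pos.trans_le hs.floor_le
  have h := utility_le_chord hp hs' hpos.le
  exact le_of_mul_le_mul_right (by linarith [hs.tangent]) hpos

theorem IsEnvelopeSlope.unique (hp : p.Admissible) {s s' : ℝ} (hs : p.IsEnvelopeSlope s)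
    (hs' : p.IsEnvelopeSlope s') : s = s' :=
  le_antisymm (hs.le hp hs') (hs'.le hp hs)

/-- Clearing the denominator turns the case conditions on `H` into signs of `tangentGap` at `x₂`. -/
theorem H_mul_top (hp : p.Admissible) :
    p.H * ((1 + p.m) * p.v₀) = 1 / (1 - p.b) * p.x₂ ^ (1 - p.b) - p.utility 0 := by
  have h1 := hp.v₀_pos.ne'
  have h2 : 1 + p.m ≠ 0 := by linarith [hp.m_mem.1]
  have h3 : 1 - p.b ≠ 0 := sub_ne_zero.2 hp.b_ne_one.symm
  rw [utility_zero hp, H, x₀]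
  field_simp

/-! ### The equation of the concavification point -/

/-- For `C = α (1 + m) v₀ - x₂`, or `C = (1 + m) v₀ - x₂`, the difference of the tangent of the
utility at the shifted wealth `w` and of the utility, both at the fund value `0`. -/
def tangentGap (p : Model) (C w : ℝ) : ℝ :=
  p.b / (1 - p.b) * w ^ (1 - p.b) - C * w ^ (-p.b) - p.utility 0

theorem tangentGap_eq (hp : p.Admissible) (C : ℝ) {w : ℝ} (hw : 0 < w) :
    p.tangentGap C w = 1 / (1 - p.b) * w ^ (1 - p.b) - w ^ (-p.b) * (w + C) - p.utility 0 := by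
  have h3 : 1 - p.b ≠ 0 := sub_ne_zero.2 hp.b_ne_one.symm
  have h0 : w ^ (1 - p.b) = w ^ (-p.b) * w := by
    rw [← Real.rpow_add_one hw.ne']; ring_nf
  rw [tangentGap, h0]
  field_simp
  ring

theorem continuousOn_tangentGap (C : ℝ) : ContinuousOn (p.tangentGap C) (Set.Ioi 0) := by
  unfold tangentGap
  have h (e : ℝ) : ContinuousOn (fun w : ℝ => w ^ e) (Set.Ioi 0) :=
    fun w hw => (Real.continuousAt_rpow_const _ _ (Or.inl (ne_of_gt hw))).continuousWithinAt
  exact ((continuousOn_const.mul (h _)).sub (continuousOn_const.mul (h _))).sub continuousOn_const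

theorem exists_tangentGap_eq_zero {C w₁ w₂ : ℝ} (h1 : 0 < w₁) (h12 : w₁ ≤ w₂)
    (h : p.tangentGap C w₁ < 0) (h' : 0 < p.tangentGap C w₂) :
    ∃ w ∈ Set.Ioo w₁ w₂, p.tangentGap C w = 0 :=
  intermediate_value_Ioo h12 ((continuousOn_tangentGap C).mono
    fun _ hx => h1.trans_le hx.1) ⟨h, h'⟩

/-- For `b < 1` the term with `w ^ (1 - b)` tends to infinity while the other power vanishes. For `b
> 1` both powers vanish and `-U_M(0) > 0` remains. -/
theorem eventually_tangentGap_pos (hp : p.Admissible) (C : ℝ) :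
    ∀ᶠ w in Filter.atTop, 0 < p.tangentGap C w := by
  have hb := hp.b_pos
  have h2 : Filter.Tendsto (fun w : ℝ => C * w ^ (-p.b)) Filter.atTop (nhds (C * 0)) :=
    (tendsto_rpow_neg_atTop hb).const_mul C
  rcases lt_or_gt_of_ne hp.b_ne_one with h | h
  · have h1 : Filter.Tendsto (fun w : ℝ => p.b / (1 - p.b) * w ^ (1 - p.b)) Filter.atTop
        Filter.atTop :=
      (tendsto_rpow_atTop (by linarith)).const_mul_atTop (div_pos hb (by linarith))
    have h3 := (h1.atTop_add (h2.neg)).eventually_gt_atTop (p.utility 0)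
    filter_upwards [h3] with w hw
    unfold tangentGap
    linarith
  · have h1 : Filter.Tendsto (fun w : ℝ => p.b / (1 - p.b) * w ^ (1 - p.b)) Filter.atTop
        (nhds (p.b / (1 - p.b) * 0)) := by
      have := (tendsto_rpow_neg_atTop (y := p.b - 1) (by linarith)).const_mul (p.b / (1 - p.b))
      simpa using this
    have h3 := (h1.sub h2).sub_const (p.utility 0)
    refine h3.eventually_const_lt ?_
    rw [utility_zero hp]
    have h4 : 1 / (1 - p.b) < 0 := one_div_neg.2 (by linarith)
    have := mul_neg_of_neg_of_pos h4 (Real.rpow_pos_of_pos (hp.x₀_pos h) (1 - p.b))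
    linarith

/-- This supplies the left endpoint for the intermediate value theorem when the wealth `0` itself
cannot be used: `x₀ = 0` forces `b < 1` and `U_M(0) = 0`, and near `0` the term `-C w ^ (-b)`
dominates. -/
theorem exists_tangentGap_neg (hp : p.Admissible) (h0 : p.x₀ = 0) {C δ : ℝ} (hC : 0 < C)
    (hδ : 0 < δ) : ∃ w ∈ Set.Ioo 0 δ, p.tangentGap C w < 0 := by
  have hb1 : p.b < 1 := by
    by_contra h
    have := hp.x₀_pos (lt_of_le_of_ne (not_lt.1 h) hp.b_ne_one.symm)
    linarith
  have hb := hp.b_pos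
  have hb1' : 0 < 1 - p.b := by linarith
  -- The gap equals `w ^ (-b) (b w / (1 - b) - C)`, which is negative exactly for `w < C (1 - b) /
  -- b`.
  have hm : 0 < min δ (C * (1 - p.b) / p.b) := lt_min hδ (by positivity)
  refine ⟨min δ (C * (1 - p.b) / p.b) / 2, ⟨by linarith, ?_⟩, ?_⟩
  · have := min_le_left δ (C * (1 - p.b) / p.b); linarith
  · set w := min δ (C * (1 - p.b) / p.b) / 2 with hw
    have hw0 : 0 < w := by linarith
    have hw1 : w < C * (1 - p.b) / p.b := by
      have := min_le_right δ (C * (1 - p.b) / p.b); linarith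
    rw [tangentGap_eq hp C hw0, utility_zero hp, h0, Real.zero_rpow hb1'.ne', mul_zero, sub_zero]
    have h1 : w ^ (1 - p.b) = w ^ (-p.b) * w := by
      rw [← Real.rpow_add_one hw0.ne']; ring_nf
    have h2 : 0 < w ^ (-p.b) := Real.rpow_pos_of_pos hw0 _
    rw [h1, show 1 / (1 - p.b) * (w ^ (-p.b) * w) - w ^ (-p.b) * (w + C) =
      w ^ (-p.b) * (p.b * w / (1 - p.b) - C) by field_simp; ring]
    refine mul_neg_of_pos_of_neg h2 (sub_neg.2 ?_)
    rw [div_lt_iff₀ hb1']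
    rw [lt_div_iff₀ hb] at hw1
    linarith

theorem x₂_rpow_mul {c : ℝ} (h : 0 < p.x₂) :
    c * p.x₂ ^ p.b * p.x₂ ^ (-p.b) = c := by
  rw [mul_assoc, ← Real.rpow_add h, add_neg_cancel, Real.rpow_zero, mul_one]

/-! ### Case A -/

/-- In terms of the shifted wealth `w` at `θ` one has `w + C = α θ`, so the equation for `θ` says
that the tangent at `θ` passes through `(0, U_M(0))`. -/
theorem isThetaA_iff (hp : p.Admissible) {θ : ℝ} (hθ : (1 + p.m) * p.v₀ < θ) :
    p.IsThetaA θ ↔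
      p.tangentGap (p.α * ((1 + p.m) * p.v₀) - p.x₂)
        (p.x₂ + p.α * (θ - (1 + p.m) * p.v₀)) = 0 := by
  set w := p.x₂ + p.α * (θ - (1 + p.m) * p.v₀) with hw
  have hw0 : 0 < w := by
    have := mul_pos hp.α_pos (sub_pos.2 hθ); linarith [hp.x₂_nonneg]
  have h3 : 1 - p.b ≠ 0 := sub_ne_zero.2 hp.b_ne_one.symm
  have h1 : w ^ (1 - p.b) = w ^ (-p.b) * w := by
    rw [← Real.rpow_add_one hw0.ne']; ring_nf
  have e1 : p.α * θ + (p.m - p.α * (1 + p.m)) * p.v₀ + p.a = w := by rw [hw, x₂]; ring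
  have e2 : p.b * p.α * θ + (p.m - p.α * (1 + p.m)) * p.v₀ + p.a =
      w + (p.b - 1) * (p.α * θ) := by rw [hw, x₂]; ring
  rw [tangentGap_eq hp _ hw0, h1, utility_zero hp, IsThetaA, e1, e2, ← x₀,
    show w + (p.α * ((1 + p.m) * p.v₀) - p.x₂) = p.α * θ by rw [hw]; ring]
  constructor
  · rintro ⟨-, h⟩
    rw [← h]; field_simp; ring
  · intro h
    refine ⟨hθ, ?_⟩
    field_simp at h
    linarith

theorem isThetaA_exists (hp : p.Admissible) (hA : p.CaseA) : ∃ θ, p.IsThetaA θ := by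
  suffices h : ∃ w₁, 0 < w₁ ∧ p.x₂ ≤ w₁ ∧
      p.tangentGap (p.α * ((1 + p.m) * p.v₀) - p.x₂) w₁ < 0 by
    obtain ⟨w₁, h1, h2, h3⟩ := h
    obtain ⟨w₂, h4, h5⟩ := ((eventually_tangentGap_pos hp
      (p.α * ((1 + p.m) * p.v₀) - p.x₂)).and (Filter.eventually_ge_atTop w₁)).exists
    obtain ⟨w, hw, hw0⟩ := exists_tangentGap_eq_zero h1 h5 h3 h4
    refine ⟨(1 + p.m) * p.v₀ + (w - p.x₂) / p.α, (isThetaA_iff hp ?_).2 ?_⟩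
    · have := div_pos (sub_pos.2 (h2.trans_lt hw.1)) hp.α_pos
      linarith
    · rw [add_sub_cancel_left, mul_div_cancel₀ _ hp.α_pos.ne', add_sub_cancel, hw0]
  -- If `x₂ > 0`, the gap at `x₂` is `(H - α x₂ ^ (-b)) (1 + m) v₀`, negative in Case A. If `x₂ =
  -- 0`, a point close to `0` replaces `x₂`.
  rcases hp.x₂_nonneg.eq_or_lt with h | h
  · have h0 : p.x₀ = 0 := le_antisymm (by rw [h]; exact hp.x₀_le_x₂) hp.x₀_nonneg
    obtain ⟨w, hw, hw0⟩ := exists_tangentGap_neg hp h0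
      (C := p.α * ((1 + p.m) * p.v₀) - p.x₂) (by rw [← h, sub_zero]; exact mul_pos hp.α_pos hp.top_pos)
      one_pos
    exact ⟨w, hw.1, by rw [← h]; exact hw.1.le, hw0⟩
  · refine ⟨p.x₂, h, le_rfl, ?_⟩
    have h1 := H_mul_top hp
    have h2 : p.H < p.α * p.x₂ ^ (-p.b) := by
      have := mul_lt_mul_of_pos_right hA (Real.rpow_pos_of_pos h (-p.b))
      rwa [x₂_rpow_mul h] at this
    have h3 := mul_lt_mul_of_pos_right h2 hp.top_pos
    rw [tangentGap_eq hp _ h, add_sub_cancel]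
    linarith

theorem slopeA_eq (p : Model) (θ : ℝ) :
    p.slopeA θ = p.α * (p.x₂ + p.α * (θ - (1 + p.m) * p.v₀)) ^ (-p.b) := by
  rw [slopeA, x₂]; ring_nf

theorem upper_wealth_slopeA (hp : p.Admissible) {θ : ℝ} (hθ : (1 + p.m) * p.v₀ < θ) :
    p.α ^ (1 / p.b) * p.slopeA θ ^ (-1 / p.b) =
      p.x₂ + p.α * (θ - (1 + p.m) * p.v₀) := by
  have hw0 : 0 < p.x₂ + p.α * (θ - (1 + p.m) * p.v₀) := by
    have := mul_pos hp.α_pos (sub_pos.2 hθ); linarith [hp.x₂_nonneg]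
  have hb := hp.b_pos
  rw [slopeA_eq, Real.mul_rpow hp.α_pos.le (Real.rpow_nonneg hw0.le _), ← mul_assoc,
    ← Real.rpow_add hp.α_pos, ← Real.rpow_mul hw0.le,
    show -p.b * (-1 / p.b) = 1 by field_simp, show 1 / p.b + -1 / p.b = 0 by ring]
  simp

theorem level_slopeA (hp : p.Admissible) {θ : ℝ} (hθ : (1 + p.m) * p.v₀ < θ) :
    p.level (p.slopeA θ ^ (-1 / p.b)) = θ := by
  have := mul_pos hp.α_pos (sub_pos.2 hθ)
  rw [level_of_upper hp (by rw [upper_wealth_slopeA hp hθ]; linarith), upper_wealth_slopeA hp hθ,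
    add_sub_cancel_left, mul_div_cancel_left₀ _ hp.α_pos.ne']
  ring

theorem isEnvelopeSlope_slopeA (hp : p.Admissible) {θ : ℝ} (h : p.IsThetaA θ) :
    p.IsEnvelopeSlope (p.slopeA θ) := by
  have hw0 : 0 < p.x₂ + p.α * (θ - (1 + p.m) * p.v₀) := by
    have := mul_pos hp.α_pos (sub_pos.2 h.1); linarith [hp.x₂_nonneg]
  have hl := level_slopeA hp h.1
  refine ⟨?_, ?_, ?_⟩
  · rw [slopeA_eq]; exact mul_pos hp.α_pos (Real.rpow_pos_of_pos hw0 _)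
  · rw [hl]; exact hp.floor_le_top.trans h.1.le
  · have h1 := (isThetaA_iff hp h.1).1 h
    rw [tangentGap_eq hp _ hw0] at h1
    rw [hl, utility_of_top_le hp h.1.le, slopeA_eq]
    linarith

/-- Uniqueness needs no monotonicity of `tangentGap`: any two solutions give the same envelope
slope, and `level` recovers the solution from its slope. -/
theorem isThetaA_unique (hp : p.Admissible) {θ θ' : ℝ} (h : p.IsThetaA θ)
    (h' : p.IsThetaA θ') : θ' = θ := by
  rw [← level_slopeA hp h.1, ← level_slopeA hp h'.1,
    (isEnvelopeSlope_slopeA hp h).unique hp (isEnvelopeSlope_slopeA hp h')]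

theorem upper_eq (hp : p.Admissible) (y z : ℝ) :
    p.upper y z = (1 + p.m) * p.v₀ + (p.α ^ (1 / p.b) * (y * z) ^ (-1 / p.b) - p.x₂) / p.α := by
  have hα := hp.α_pos.ne'
  rw [upper, x₂, Real.rpow_sub_one hα]
  field_simp
  ring

theorem upper_wealth_of_le_slopeA (hp : p.Admissible) {θ l : ℝ} (hθ : p.IsThetaA θ) (hl : 0 < l)
    (h : l ≤ p.slopeA θ) : p.x₂ ≤ p.α ^ (1 / p.b) * l ^ (-1 / p.b) := by
  have h1 := mul_pos hp.α_pos (sub_pos.2 hθ.1)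
  have h2 := mul_le_mul_of_nonneg_left (rpow_neg_one_div_anti hp hl h)
    (Real.rpow_nonneg hp.α_pos.le (1 / p.b))
  rw [upper_wealth_slopeA hp hθ.1] at h2
  linarith

theorem fundA_eq_policy (hp : p.Admissible) {θ y z : ℝ} (hθ : p.IsThetaA θ) (hy : 0 < y)
    (hz : 0 < z) : p.fundA θ y z = p.policy (p.slopeA θ) (y * z) := by
  have h1 : z ≤ p.slopeA θ / y ↔ y * z ≤ p.slopeA θ := by rw [le_div_iff₀' hy]
  simp only [fundA, policy, Set.indicator, Set.mem_Ioc, hz, true_and, h1]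
  split_ifs with h
  · rw [upper_eq hp, level_of_upper hp (upper_wealth_of_le_slopeA hp hθ (mul_pos hy hz) h)]
  · rfl

/-! ### The three regions of the policy if `x₂ > 0` -/

theorem x₂_le_upper_iff (hp : p.Admissible) (h : 0 < p.x₂) {l : ℝ} (hl : 0 < l) :
    p.x₂ ≤ p.α ^ (1 / p.b) * l ^ (-1 / p.b) ↔ l ≤ p.α * p.x₂ ^ (-p.b) := by
  have hw : 0 < p.α ^ (1 / p.b) * l ^ (-1 / p.b) :=
    mul_pos (Real.rpow_pos_of_pos hp.α_pos _) (Real.rpow_pos_of_pos hl _)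
  rw [← Real.rpow_le_rpow_iff_of_neg hw h (neg_neg_of_pos hp.b_pos), α_rpow_mul_rpow hp hl,
    div_le_iff₀' hp.α_pos]

theorem x₂_le_lower_iff (hp : p.Admissible) (h : 0 < p.x₂) {l : ℝ} (hl : 0 < l) :
    p.x₂ ≤ l ^ (-1 / p.b) ↔ l ≤ p.x₂ ^ (-p.b) := by
  rw [← Real.rpow_le_rpow_iff_of_neg (Real.rpow_pos_of_pos hl _) h (neg_neg_of_pos hp.b_pos),
    rpow_neg_one_div_rpow hp hl]

theorem α_mul_le (hp : p.Admissible) (h : 0 < p.x₂) :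
    p.α * p.x₂ ^ (-p.b) ≤ p.x₂ ^ (-p.b) :=
  mul_le_of_le_one_left (Real.rpow_nonneg h.le _) hp.α_mem.2

theorem level_eq_upper (hp : p.Admissible) (h : 0 < p.x₂) {l : ℝ} (hl : 0 < l)
    (h1 : l ≤ p.α * p.x₂ ^ (-p.b)) : p.level (l ^ (-1 / p.b)) =
      (1 + p.m) * p.v₀ + (p.α ^ (1 / p.b) * l ^ (-1 / p.b) - p.x₂) / p.α :=
  level_of_upper hp ((x₂_le_upper_iff hp h hl).2 h1)

theorem level_eq_kink (hp : p.Admissible) (h : 0 < p.x₂) {l : ℝ} (hl : 0 < l)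
    (h1 : p.α * p.x₂ ^ (-p.b) ≤ l) (h2 : l ≤ p.x₂ ^ (-p.b)) :
    p.level (l ^ (-1 / p.b)) = (1 + p.m) * p.v₀ := by
  refine level_of_kink hp ?_ ((x₂_le_lower_iff hp h hl).2 h2)
  have hw : 0 < p.α ^ (1 / p.b) * l ^ (-1 / p.b) :=
    mul_pos (Real.rpow_pos_of_pos hp.α_pos _) (Real.rpow_pos_of_pos hl _)
  rwa [← Real.rpow_le_rpow_iff_of_neg h hw (neg_neg_of_pos hp.b_pos), α_rpow_mul_rpow hp hl,
    le_div_iff₀' hp.α_pos]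

theorem level_eq_lower (hp : p.Admissible) (h : 0 < p.x₂) {l : ℝ} (hl : 0 < l)
    (h1 : p.x₂ ^ (-p.b) ≤ l) :
    p.level (l ^ (-1 / p.b)) = (1 + p.m) * p.v₀ + (l ^ (-1 / p.b) - p.x₂) := by
  refine level_of_lower hp (Real.rpow_nonneg hl.le _) ?_
  rwa [← Real.rpow_le_rpow_iff_of_neg h (Real.rpow_pos_of_pos hl _) (neg_neg_of_pos hp.b_pos),
    rpow_neg_one_div_rpow hp hl]

/-! ### Case B -/

theorem CaseB.x₂_pos (hp : p.Admissible) (hB : p.CaseB) : 0 < p.x₂ := by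
  refine hp.x₂_nonneg.lt_of_ne' fun h => ?_
  have := hB.1
  rw [h, Real.zero_rpow hp.b_pos.ne', mul_zero] at this
  linarith [hp.α_pos]

theorem CaseB.le_slopeB (hp : p.Admissible) (hB : p.CaseB) :
    p.α * p.x₂ ^ (-p.b) ≤ p.slopeB := by
  have h := CaseB.x₂_pos hp hB
  have := mul_le_mul_of_nonneg_right hB.1 (Real.rpow_nonneg h.le (-p.b))
  rwa [x₂_rpow_mul h] at this

theorem CaseB.slopeB_le (hp : p.Admissible) (hB : p.CaseB) :
    p.slopeB ≤ p.x₂ ^ (-p.b) := by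
  have h := CaseB.x₂_pos hp hB
  have := mul_le_mul_of_nonneg_right hB.2 (Real.rpow_nonneg h.le (-p.b))
  rwa [x₂_rpow_mul h, one_mul] at this

theorem CaseB.slopeB_pos (hp : p.Admissible) (hB : p.CaseB) : 0 < p.slopeB :=
  (mul_pos hp.α_pos (Real.rpow_pos_of_pos (CaseB.x₂_pos hp hB) _)).trans_le
    (CaseB.le_slopeB hp hB)

/-- In Case B the chord slope `H` lies between the one-sided slopes at the kink, so the chord to the
kink is itself the supporting line. -/
theorem isEnvelopeSlope_slopeB (hp : p.Admissible) (hB : p.CaseB) :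
    p.IsEnvelopeSlope p.slopeB := by
  have h := level_eq_kink hp (CaseB.x₂_pos hp hB) (CaseB.slopeB_pos hp hB)
    (CaseB.le_slopeB hp hB) (CaseB.slopeB_le hp hB)
  refine ⟨CaseB.slopeB_pos hp hB, ?_, ?_⟩
  · rw [h]; exact hp.floor_le_top
  · rw [h, utility_of_top_le hp le_rfl, sub_self, mul_zero, add_zero, slopeB]
    linarith [H_mul_top hp]

theorem fundB_eq_policy (hp : p.Admissible) {y z : ℝ} (hB : p.CaseB) (hy : 0 < y)
    (hz : 0 < z) : p.fundB y z = p.policy p.slopeB (y * z) := by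
  have hx := CaseB.x₂_pos hp hB
  have hl := mul_pos hy hz
  have h12 := CaseB.le_slopeB hp hB
  have h23 := CaseB.slopeB_le hp hB
  simp only [fundB, policy, Set.indicator, Set.mem_Ioo, Set.mem_Icc, hz, true_and,
    le_div_iff₀' hy, lt_div_iff₀' hy, div_le_iff₀' hy]
  rcases lt_or_ge (y * z) (p.α * p.x₂ ^ (-p.b)) with h | h
  · rw [if_pos h, if_neg (by simp [h]), if_pos (h.le.trans h12), upper_eq hp,
      level_eq_upper hp hx hl h.le, add_zero]
  · rw [if_neg h.not_gt, zero_add]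
    by_cases h' : y * z ≤ p.slopeB
    · rw [if_pos ⟨h, h'⟩, if_pos h', level_eq_kink hp hx hl h (h'.trans h23)]
    · rw [if_neg (by simp [h']), if_neg h']

/-! ### Case C -/

theorem CaseC.x₂_pos (hp : p.Admissible) (hC : p.CaseC) : 0 < p.x₂ := by
  refine hp.x₂_nonneg.lt_of_ne' fun h => ?_
  rw [CaseC, h, Real.zero_rpow hp.b_pos.ne', mul_zero] at hC
  linarith

theorem isThetaC_iff (hp : p.Admissible) {θ : ℝ} (h₁ : p.floor < θ)
    (h₂ : θ < (1 + p.m) * p.v₀) :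
    p.IsThetaC θ ↔
      p.tangentGap ((1 + p.m) * p.v₀ - p.x₂) (p.x₂ + (θ - (1 + p.m) * p.v₀)) = 0 := by
  set w := p.x₂ + (θ - (1 + p.m) * p.v₀) with hw
  have hw0 : 0 < w := by
    have := Admissible.x₂_eq p
    rw [Admissible.floor_eq] at h₁
    linarith [hp.x₀_nonneg]
  have h3 : 1 - p.b ≠ 0 := sub_ne_zero.2 hp.b_ne_one.symm
  have h1 : w ^ (1 - p.b) = w ^ (-p.b) * w := by
    rw [← Real.rpow_add_one hw0.ne']; ring_nf
  have e1 : θ - p.v₀ + p.a = w := by rw [hw, x₂]; ring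
  have e2 : p.b * θ - p.v₀ + p.a = w + (p.b - 1) * θ := by rw [hw, x₂]; ring
  rw [tangentGap_eq hp _ hw0, h1, utility_zero hp, IsThetaC, e1, e2, ← x₀,
    show w + ((1 + p.m) * p.v₀ - p.x₂) = θ by rw [hw]; ring]
  constructor
  · rintro ⟨-, -, h⟩
    rw [← h]; field_simp; ring
  · intro h
    refine ⟨h₁, h₂, ?_⟩
    field_simp at h
    linarith

/-- Case C makes the gap positive at `x₂`. At the wealth `x₀`, that is at `floor`, the gap is `-x₀ ^
(-b)` times `floor`, hence negative; if `x₀ = 0`, a small positive wealth is used instead. -/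
theorem isThetaC_exists (hp : p.Admissible) (hC : p.CaseC) : ∃ θ, p.IsThetaC θ := by
  have hx := CaseC.x₂_pos hp hC
  have hx02 : p.x₀ ≠ p.x₂ := by
    intro h
    have h1 := H_mul_top hp
    rw [utility_zero hp, h, sub_self] at h1
    rw [CaseC, (mul_eq_zero.1 h1).resolve_right hp.top_pos.ne', zero_mul] at hC
    linarith
  have hx02' := hp.x₀_le_x₂.lt_of_ne hx02
  have hup : 0 < p.tangentGap ((1 + p.m) * p.v₀ - p.x₂) p.x₂ := by
    have h2 : p.x₂ ^ (-p.b) < p.H := by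
      have := mul_lt_mul_of_pos_right hC (Real.rpow_pos_of_pos hx (-p.b))
      rwa [x₂_rpow_mul hx, one_mul] at this
    have h3 := mul_lt_mul_of_pos_right h2 hp.top_pos
    rw [tangentGap_eq hp _ hx, add_sub_cancel]
    linarith [H_mul_top hp]
  suffices h : ∃ w₁, 0 < w₁ ∧ p.x₀ ≤ w₁ ∧ w₁ ≤ p.x₂ ∧
      p.tangentGap ((1 + p.m) * p.v₀ - p.x₂) w₁ < 0 by
    obtain ⟨w₁, h1, h2, h2', h3⟩ := h
    obtain ⟨w, hw, hw0⟩ := exists_tangentGap_eq_zero h1 h2' h3 hup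
    refine ⟨(1 + p.m) * p.v₀ + (w - p.x₂), (isThetaC_iff hp ?_ ?_).2 ?_⟩
    · rw [Admissible.floor_eq]
      linarith [Admissible.x₂_eq p, hw.1]
    · linarith [hw.2]
    · rw [add_sub_cancel_left, add_sub_cancel, hw0]
  have hfl : p.x₀ + ((1 + p.m) * p.v₀ - p.x₂) = p.floor := by
    rw [Admissible.floor_eq, Admissible.x₂_eq]; ring
  rcases hp.x₀_nonneg.eq_or_lt with h | h
  · obtain ⟨w, hw, hw0⟩ := exists_tangentGap_neg hp h.symm
      (C := (1 + p.m) * p.v₀ - p.x₂) (by linarith [hp.floor_pos]) hx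
    exact ⟨w, hw.1, by rw [← h]; exact hw.1.le, hw.2.le, hw0⟩
  · refine ⟨p.x₀, h, le_rfl, hx02'.le, ?_⟩
    rw [tangentGap_eq hp _ h, hfl, utility_zero hp]
    have := mul_pos (Real.rpow_pos_of_pos h (-p.b)) hp.floor_pos
    linarith

theorem slopeC_eq (p : Model) (θ : ℝ) :
    p.slopeC θ = (p.x₂ + (θ - (1 + p.m) * p.v₀)) ^ (-p.b) := by
  rw [slopeC, x₂]; ring_nf

theorem IsThetaC.wealth_pos (hp : p.Admissible) {θ : ℝ} (h : p.IsThetaC θ) :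
    0 < p.x₂ + (θ - (1 + p.m) * p.v₀) := by
  have := Admissible.x₂_eq p
  have h1 : p.floor < θ := h.1
  rw [Admissible.floor_eq] at h1
  linarith [hp.x₀_nonneg]

theorem IsThetaC.x₂_pos (hp : p.Admissible) {θ : ℝ} (h : p.IsThetaC θ) : 0 < p.x₂ := by
  linarith [h.wealth_pos hp, h.2.1]

theorem IsThetaC.lt_slopeC (hp : p.Admissible) {θ : ℝ} (h : p.IsThetaC θ) :
    p.x₂ ^ (-p.b) < p.slopeC θ := by
  rw [slopeC_eq]
  exact Real.rpow_lt_rpow_of_neg (h.wealth_pos hp) (by linarith [h.2.1]) (by linarith [hp.b_pos])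

theorem level_slopeC (hp : p.Admissible) {θ : ℝ} (h : p.IsThetaC θ) :
    p.level (p.slopeC θ ^ (-1 / p.b)) = θ := by
  have hb := hp.b_pos
  have hw := h.wealth_pos hp
  rw [level_eq_lower hp (h.x₂_pos hp) (by rw [slopeC_eq]; exact Real.rpow_pos_of_pos hw _)
    (h.lt_slopeC hp).le, slopeC_eq, ← Real.rpow_mul hw.le,
    show -p.b * (-1 / p.b) = 1 by field_simp, Real.rpow_one]
  ring

theorem isEnvelopeSlope_slopeC (hp : p.Admissible) {θ : ℝ} (h : p.IsThetaC θ) :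
    p.IsEnvelopeSlope (p.slopeC θ) := by
  have hw0 := h.wealth_pos hp
  have hl := level_slopeC hp h
  have hfl : p.floor < θ := h.1
  refine ⟨?_, ?_, ?_⟩
  · rw [slopeC_eq]; exact Real.rpow_pos_of_pos hw0 _
  · rw [hl]; exact hfl.le
  · have h1 := (isThetaC_iff hp hfl h.2.1).1 h
    rw [tangentGap_eq hp _ hw0] at h1
    rw [hl, utility_of_le_top hp hfl.le h.2.1.le, slopeC_eq]
    linarith

theorem isThetaC_unique (hp : p.Admissible) {θ θ' : ℝ} (h : p.IsThetaC θ)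
    (h' : p.IsThetaC θ') : θ' = θ := by
  rw [← level_slopeC hp h, ← level_slopeC hp h',
    (isEnvelopeSlope_slopeC hp h).unique hp (isEnvelopeSlope_slopeC hp h')]

theorem fundC_eq_policy (hp : p.Admissible) {θ y z : ℝ} (hθ : p.IsThetaC θ) (hy : 0 < y)
    (hz : 0 < z) : p.fundC θ y z = p.policy (p.slopeC θ) (y * z) := by
  have hx := hθ.x₂_pos hp
  have hl := mul_pos hy hz
  have h12 := α_mul_le hp hx
  have h23 := hθ.lt_slopeC hp
  simp only [fundC, policy, Set.indicator, Set.mem_Ioo, Set.mem_Icc, Set.mem_Ioc, hz, true_and,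
    le_div_iff₀' hy, lt_div_iff₀' hy, div_le_iff₀' hy, div_lt_iff₀' hy]
  rcases lt_or_ge (y * z) (p.α * p.x₂ ^ (-p.b)) with h | h
  · rw [if_pos h, if_neg (by simp [h]), if_neg (fun h' => by linarith [h'.1]),
      if_pos (by linarith), upper_eq hp, level_eq_upper hp hx hl h.le, add_zero, add_zero]
  rw [if_neg h.not_gt, zero_add]
  rcases le_or_gt (y * z) (p.x₂ ^ (-p.b)) with h' | h'
  · rw [if_pos ⟨h, h'⟩, if_neg (fun h'' => by linarith [h''.1]), if_pos (by linarith),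
      level_eq_kink hp hx hl h h', add_zero]
  rw [if_neg (fun h'' => by linarith [h''.2]), zero_add]
  by_cases h3 : y * z ≤ p.slopeC θ
  · rw [if_pos ⟨h', h3⟩, if_pos h3, level_eq_lower hp hx hl h'.le, x₂]
    ring
  · rw [if_neg (by simp [h3]), if_neg h3]

end Model

/-! ### The standard normal distribution -/

/-- The standard normal distribution. -/
abbrev stdNormal : Measure ℝ := gaussianReal 0 1

theorem stdNormal_singleton (x : ℝ) : stdNormal {x} = 0 := by
  have := nullSingletonClass_gaussianReal (μ := 0) (v := 1) one_ne_zero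
  exact measure_singleton x

theorem stdNormal_Ici_ne_zero (q : ℝ) : stdNormal (Set.Ici q) ≠ 0 := fun h => by
  have := gaussianReal_absolutelyContinuous' 0 (v := 1) one_ne_zero h
  simp at this

theorem Model.Φ_eq (q : ℝ) : Model.Φ q = stdNormal.real (Set.Iio q) := by
  have := nullSingletonClass_gaussianReal (μ := 0) (v := 1) one_ne_zero
  rw [Model.Φ, cdf_eq_real]
  exact measureReal_congr Iio_ae_eq_Iic.symm

theorem stdNormal_real_Ici (q : ℝ) : stdNormal.real (Set.Ici q) = 1 - Model.Φ q := by
  rw [Model.Φ_eq, ← Set.compl_Iio, probReal_compl_eq_one_sub measurableSet_Iio]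

/-- Exponential tilting of the standard normal distribution. -/
theorem integral_exp_mul_stdNormal (t : ℝ) (f : ℝ → ℝ) :
    ∫ n, Real.exp (t * n) * f n ∂stdNormal = Real.exp (t ^ 2 / 2) * ∫ n, f (n + t) ∂stdNormal := by
  rw [integral_gaussianReal_eq_integral_smul one_ne_zero,
    integral_gaussianReal_eq_integral_smul one_ne_zero, ← integral_const_mul,
    ← integral_add_right_eq_self _ t]
  congr 1 with n
  have h : Real.exp (-(n + t) ^ 2 / 2) * Real.exp (t * (n + t)) =
      Real.exp (t ^ 2 / 2) * Real.exp (-n ^ 2 / 2) := by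
    rw [← Real.exp_add, ← Real.exp_add]; ring_nf
  simp only [gaussianPDFReal, smul_eq_mul, sub_zero, NNReal.coe_one, mul_one]
  linear_combination (√(2 * Real.pi))⁻¹ * f (n + t) * h

theorem setIntegral_exp_mul_stdNormal (t q : ℝ) :
    ∫ n in Set.Ici q, Real.exp (t * n) ∂stdNormal =
      Real.exp (t ^ 2 / 2) * (1 - Model.Φ (q - t)) := by
  have h1 := integral_exp_mul_stdNormal t ((Set.Ici q).indicator 1)
  have h2 : (fun n => (Set.Ici q).indicator (1 : ℝ → ℝ) (n + t)) =
      (Set.Ici (q - t)).indicator 1 := by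
    ext n; simp [Set.indicator]
  rw [h2, integral_indicator_one measurableSet_Ici, stdNormal_real_Ici] at h1
  rw [← h1, ← integral_indicator measurableSet_Ici]
  congr 1 with n
  by_cases h : n ∈ Set.Ici q <;> simp [h]

/-! ### The state price density as a function of a standard normal variable. -/

namespace Model

variable {p : Model}

/-- The state price density at the horizon as a function of the standardized Wiener process. -/
def price (p : Model) (n : ℝ) : ℝ :=
  Real.exp (-(p.r + p.γ ^ 2 / 2) * p.T - p.γ * √p.T * n)

theorem price_pos (n : ℝ) : 0 < p.price n := Real.exp_pos _

theorem continuous_price : Continuous p.price := by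
  unfold price; fun_prop

theorem measurable_price : Measurable p.price := continuous_price.measurable

theorem price_rpow (e n : ℝ) : p.price n ^ e =
    Real.exp (-(p.r + p.γ ^ 2 / 2) * p.T * e) * Real.exp (-(e * (p.γ * √p.T)) * n) := by
  rw [price, ← Real.exp_mul, ← Real.exp_add]
  ring_nf

theorem integrable_price_rpow (e : ℝ) : Integrable (fun n => p.price n ^ e) stdNormal := by
  simp_rw [price_rpow]
  exact (integrable_exp_mul_gaussianReal _).const_mul _

theorem integrable_price : Integrable p.price stdNormal := by
  simpa using integrable_price_rpow (p := p) 1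

theorem Admissible.γ_sqrt_pos (hp : p.Admissible) : 0 < p.γ * √p.T :=
  mul_pos hp.γ_pos (Real.sqrt_pos.2 hp.T_pos)

theorem price_antitone (hp : p.Admissible) : Antitone p.price := fun n n' h => by
  have := mul_le_mul_of_nonneg_left h hp.γ_sqrt_pos.le
  exact Real.exp_le_exp.2 (by linarith)

/-- The exponent is `1 - 1 / b`, so the tilt parameter is `-shift`; its Gaussian factor together
with the deterministic part of the density is `ξ₁`. -/
theorem setIntegral_price_rpow (hp : p.Admissible) (q : ℝ) :
    ∫ n in Set.Ici q, p.price n ^ ((p.b - 1) / p.b) ∂stdNormal =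
      p.ξ₁ * (1 - Φ (q + p.shift)) := by
  have hb := hp.b_pos.ne'
  simp_rw [price_rpow]
  rw [integral_const_mul, setIntegral_exp_mul_stdNormal, ← mul_assoc, ← Real.exp_add, ξ₁, shift]
  congr 2
  · have hT : √(p.T : ℝ) ^ 2 = p.T := Real.sq_sqrt p.T.2
    rw [neg_sq, mul_pow, mul_pow p.γ, hT]
    field_simp
    ring
  · congr 1
    field_simp
    ring

/-- This is what `d` is for: `d y` is the point where `y` times the price equals `1`, so price
thresholds become thresholds for the normal variable. -/
theorem mul_price_eq (hp : p.Admissible) {y : ℝ} (hy : 0 < y) (n : ℝ) :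
    y * p.price n = Real.exp (p.γ * √p.T * (p.d y - n)) := by
  have := hp.γ_sqrt_pos.ne'
  rw [mul_sub, d, mul_div_cancel₀ _ this, price]
  nth_rw 1 [← Real.exp_log hy]
  rw [← Real.exp_add]
  ring_nf

theorem mul_price_le_iff (hp : p.Admissible) {y s : ℝ} (hy : 0 < y) (hs : 0 < s) (n : ℝ) :
    y * p.price n ≤ s ↔ p.d (y / s) ≤ n := by
  rw [← div_le_one hs, mul_div_right_comm, mul_price_eq hp (div_pos hy hs), Real.exp_le_one_iff]
  rw [← neg_nonneg, ← mul_neg, mul_nonneg_iff_of_pos_left hp.γ_sqrt_pos, neg_nonneg, sub_nonpos]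

theorem lt_mul_price_iff (hp : p.Admissible) {y s : ℝ} (hy : 0 < y) (hs : 0 < s) (n : ℝ) :
    s < y * p.price n ↔ n < p.d (y / s) := by
  rw [← not_le, mul_price_le_iff hp hy hs, not_le]

theorem le_mul_price_iff (hp : p.Admissible) {y s : ℝ} (hy : 0 < y) (hs : 0 < s) (n : ℝ) :
    s ≤ y * p.price n ↔ n ≤ p.d (y / s) := by
  rw [← one_le_div hs, mul_div_right_comm, mul_price_eq hp (div_pos hy hs), Real.one_le_exp_iff]
  rw [mul_nonneg_iff_of_pos_left hp.γ_sqrt_pos, sub_nonneg]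

theorem d_le_d (hp : p.Admissible) {q q' : ℝ} (hq : 0 < q) (h : q ≤ q') : p.d q ≤ p.d q' := by
  have := hp.γ_sqrt_pos
  unfold d
  gcongr

/-! ### The budget equation -/

theorem measurable_policy (s : ℝ) : Measurable (p.policy s) :=
  Measurable.ite measurableSet_Iic (continuous_level.measurable.comp (by fun_prop))
    measurable_const

/-- A constant plus a power of the price suffices for domination, since the price has moments of all
real orders. -/
theorem policy_le (hp : p.Admissible) {s l : ℝ} (hl : 0 < l) :
    p.policy s l ≤ (1 + p.m) * p.v₀ + p.α ^ (1 / p.b) / p.α * l ^ (-1 / p.b) := by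
  have hα := hp.α_pos
  have h0 : 0 ≤ p.α ^ (1 / p.b) / p.α * l ^ (-1 / p.b) := by positivity
  unfold policy
  split_ifs
  · unfold level
    gcongr
    refine max_le ?_ ((min_le_left _ _).trans h0)
    rw [sub_div, mul_div_right_comm]
    linarith [div_nonneg hp.x₂_nonneg hα.le]
  · linarith [hp.top_pos]

theorem integrable_policy (hp : p.Admissible) {s y : ℝ} (hs : p.IsEnvelopeSlope s) (hy : 0 < y) :
    Integrable (fun n => p.policy s (y * p.price n)) stdNormal := by
  have hb : Integrable (fun n => (1 + p.m) * p.v₀ +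
      p.α ^ (1 / p.b) / p.α * (y ^ (-1 / p.b) * p.price n ^ (-1 / p.b))) stdNormal :=
    (integrable_const _).add (((integrable_price_rpow _).const_mul _).const_mul _)
  refine hb.mono' ((measurable_policy s).comp
    (measurable_const.mul measurable_price)).aestronglyMeasurable (ae_of_all _ fun n => ?_)
  have hl := mul_pos hy (price_pos (p := p) n)
  rw [Real.norm_of_nonneg (policy_nonneg hp hs hl), ← Real.mul_rpow hy.le (price_pos n).le]
  exact policy_le hp hl

theorem integrable_price_mul_policy (hp : p.Admissible) {s y : ℝ} (hs : p.IsEnvelopeSlope s)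
    (hy : 0 < y) : Integrable (fun n => p.price n * p.policy s (y * p.price n)) stdNormal := by
  have hb : Integrable (fun n => (1 + p.m) * p.v₀ * p.price n +
      p.α ^ (1 / p.b) / p.α * (y ^ (-1 / p.b) * p.price n ^ (-1 / p.b + 1))) stdNormal :=
    (integrable_price.const_mul _).add (((integrable_price_rpow _).const_mul _).const_mul _)
  refine hb.mono' (measurable_price.mul ((measurable_policy s).comp
    (measurable_const.mul measurable_price))).aestronglyMeasurable (ae_of_all _ fun n => ?_)
  have hP := price_pos (p := p) n
  have hl := mul_pos hy hP
  rw [Real.norm_of_nonneg (mul_nonneg hP.le (policy_nonneg hp hs hl))]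
  calc p.price n * p.policy s (y * p.price n) ≤ p.price n * _ :=
        mul_le_mul_of_nonneg_left (policy_le hp hl) hP.le
    _ = _ := by
        rw [Real.mul_rpow hy.le hP.le, Real.rpow_add_one hP.ne']; ring

/-- The cost of the optimal fund value with the multiplier `y`. -/
def cost (p : Model) (s y : ℝ) : ℝ := ∫ n, p.price n * p.policy s (y * p.price n) ∂stdNormal

theorem continuousAt_policy {s l : ℝ} (hl : 0 < l) (h : l ≠ s) :
    ContinuousAt (p.policy s) l := by
  rcases lt_or_gt_of_ne h with h | h
  · have h1 : p.policy s =ᶠ[nhds l] fun l => p.level (l ^ (-1 / p.b)) := by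
      filter_upwards [gt_mem_nhds h] with x hx
      rw [policy, if_pos hx.le]
    refine ContinuousAt.congr ?_ h1.symm
    exact continuous_level.continuousAt.comp (Real.continuousAt_rpow_const _ _ (Or.inl hl.ne'))
  · have h1 : p.policy s =ᶠ[nhds l] fun _ => 0 := by
      filter_upwards [lt_mem_nhds h] with x hx
      rw [policy, if_neg (not_le.2 hx)]
    exact continuousAt_const.congr h1.symm

/-- The policy may jump only at the price `s`, which is attained at the single point `d (y / s)`, a
null set. -/
theorem continuousAt_cost (hp : p.Admissible) {s y : ℝ} (hs : p.IsEnvelopeSlope s)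
    (hy : 0 < y) : ContinuousAt (p.cost s) y := by
  refine continuousAt_of_dominated
    -- The policy decreases in the price, so its value at `y / 2` dominates for all multipliers near
    -- `y`.
    (bound := fun n => p.price n * p.policy s (y / 2 * p.price n)) ?_ ?_
    (integrable_price_mul_policy hp hs (half_pos hy)) ?_
  · exact Filter.Eventually.of_forall fun z => (measurable_price.mul ((measurable_policy s).comp
      (measurable_const.mul measurable_price))).aestronglyMeasurable
  · filter_upwards [lt_mem_nhds (half_lt_self hy)] with z hz
    refine ae_of_all _ fun n => ?_
    have hP := price_pos (p := p) n
    have hz0 : 0 < z := (half_pos hy).trans hz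
    rw [Real.norm_of_nonneg (mul_nonneg hP.le (policy_nonneg hp hs (mul_pos hz0 hP)))]
    have := policy_antitone hp hs (mul_pos (half_pos hy) hP)
      (mul_le_mul_of_nonneg_right hz.le hP.le)
    gcongr
  · have h1 : ∀ᵐ n ∂stdNormal, n ≠ p.d (y / s) := by
      rw [ae_iff]; simpa using stdNormal_singleton (p.d (y / s))
    filter_upwards [h1] with n hn
    have hne : y * p.price n ≠ s := fun h => hn
      (le_antisymm ((le_mul_price_iff hp hy hs.pos n).1 h.ge)
        ((mul_price_le_iff hp hy hs.pos n).1 h.le))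
    exact continuousAt_const.mul (ContinuousAt.comp (g := p.policy s)
      (continuousAt_policy (mul_pos hy (price_pos n)) hne) (by fun_prop))

theorem tendsto_cost_atTop (hp : p.Admissible) {s : ℝ} (hs : p.IsEnvelopeSlope s) :
    Filter.Tendsto (p.cost s) Filter.atTop (nhds 0) := by
  have h := tendsto_integral_filter_of_dominated_convergence (μ := stdNormal) (l := Filter.atTop)
    (F := fun y n => p.price n * p.policy s (y * p.price n)) (f := fun _ => 0)
    (fun n => p.price n * p.policy s (1 * p.price n)) ?_ ?_
    (integrable_price_mul_policy hp hs one_pos) ?_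
  · rwa [integral_zero] at h
  · exact Filter.Eventually.of_forall fun z => (measurable_price.mul ((measurable_policy s).comp
      (measurable_const.mul measurable_price))).aestronglyMeasurable
  · filter_upwards [Filter.eventually_ge_atTop 1] with z hz
    refine ae_of_all _ fun n => ?_
    have hP := price_pos (p := p) n
    rw [Real.norm_of_nonneg (mul_nonneg hP.le
      (policy_nonneg hp hs (mul_pos (one_pos.trans_le hz) hP)))]
    have := policy_antitone hp hs (mul_pos one_pos hP)
      (mul_le_mul_of_nonneg_right hz hP.le)
    gcongr
  · refine ae_of_all _ fun n => tendsto_const_nhds.congr' ?_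
    have hP := price_pos (p := p) n
    filter_upwards [Filter.eventually_gt_atTop (s / p.price n)] with z hz
    rw [policy, if_neg (not_le.2 ((div_lt_iff₀ hP).1 hz)), mul_zero]

theorem tendsto_rpow_neg_one_div (hp : p.Admissible) :
    Filter.Tendsto (fun l : ℝ => l ^ (-1 / p.b)) (nhdsWithin 0 (Set.Ioi 0)) Filter.atTop :=
  tendsto_rpow_neg_nhdsGT_zero (div_neg_of_neg_of_pos (by norm_num) hp.b_pos)

theorem exists_upper_region (hp : p.Admissible) {s : ℝ} (hs : p.IsEnvelopeSlope s) (K : ℝ) :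
    ∃ l, 0 < l ∧ l ≤ s ∧ K ≤ p.α ^ (1 / p.b) * l ^ (-1 / p.b) := by
  have h1 := ((tendsto_rpow_neg_one_div hp).const_mul_atTop
    (Real.rpow_pos_of_pos hp.α_pos (1 / p.b))).eventually_ge_atTop K
  have h2 : ∀ᶠ l in nhdsWithin (0 : ℝ) (Set.Ioi 0), l ≤ s :=
    nhdsWithin_le_nhds ((gt_mem_nhds hs.pos).mono fun _ h => h.le)
  obtain ⟨l, h, h', h''⟩ := (h1.and (h2.and self_mem_nhdsWithin)).exists
  exact ⟨l, h'', h', h⟩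

/-- The half-line `n ≥ 0` carries the positive price mass `e`. With `y = l / price 0` all prices
there are at most `l`, so the policy is at least its value at `l`, which exceeds `K / e` for small
`l`. -/
theorem exists_lt_cost (hp : p.Admissible) {s : ℝ} (hs : p.IsEnvelopeSlope s) (K : ℝ) :
    ∃ y, 0 < y ∧ K ≤ p.cost s y := by
  set e := ∫ n in Set.Ici 0, p.price n ∂stdNormal with he
  have he0 : 0 < e := by
    rw [he, setIntegral_pos_iff_support_of_nonneg_ae (ae_of_all _ fun n => (price_pos n).le)
      integrable_price.integrableOn, Function.support_eq_univ fun n => (price_pos n).ne',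
      Set.univ_inter]
    exact pos_iff_ne_zero.2 (stdNormal_Ici_ne_zero 0)
  obtain ⟨l, hl, hls, hlK⟩ := exists_upper_region hp hs (p.x₂ + p.α * |K / e|)
  have hα := hp.α_pos
  have hK : K / e ≤ p.policy s l := by
    rw [policy, if_pos hls, level_of_upper hp (by linarith [mul_nonneg hα.le (abs_nonneg (K / e))])]
    have : |K / e| ≤ (p.α ^ (1 / p.b) * l ^ (-1 / p.b) - p.x₂) / p.α := by
      rw [le_div_iff₀ hα]; linarith
    linarith [le_abs_self (K / e), hp.top_pos]
  have hP0 := price_pos (p := p) 0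
  have hy : 0 < l / p.price 0 := div_pos hl hP0
  refine ⟨l / p.price 0, hy, ?_⟩
  have hint := integrable_price_mul_policy hp hs hy
  calc K ≤ e * p.policy s l := by rwa [← div_le_iff₀' he0]
    _ = ∫ n in Set.Ici 0, p.price n * p.policy s l ∂stdNormal := by rw [integral_mul_const]
    _ ≤ ∫ n in Set.Ici 0, p.price n * p.policy s (l / p.price 0 * p.price n) ∂stdNormal := by
        refine setIntegral_mono_on (integrable_price.mul_const _).integrableOn hint.integrableOn
          measurableSet_Ici fun n hn => ?_
        have hP := price_pos (p := p) n
        refine mul_le_mul_of_nonneg_left (policy_antitone hp hs (mul_pos hy hP) ?_) hP.le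
        rw [div_mul_eq_mul_div, div_le_iff₀ hP0]
        exact mul_le_mul_of_nonneg_left (price_antitone hp hn) hl.le
    _ ≤ _ := setIntegral_le_integral hint (ae_of_all _ fun n => mul_nonneg (price_pos n).le
        (policy_nonneg hp hs (mul_pos hy (price_pos n))))

theorem exists_cost_eq (hp : p.Admissible) {s : ℝ} (hs : p.IsEnvelopeSlope s) :
    ∃ y, 0 < y ∧ p.cost s y = p.v₀ := by
  obtain ⟨y₁, h1, h1'⟩ := exists_lt_cost hp hs p.v₀
  obtain ⟨y₂, h2, h2'⟩ := (((tendsto_cost_atTop hp hs).eventually_lt_const hp.v₀_pos).and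
    (Filter.eventually_ge_atTop y₁)).exists
  obtain ⟨y, hy, hy'⟩ := intermediate_value_Icc' h2' (f := p.cost s)
    (fun z hz => (continuousAt_cost hp hs (h1.trans_le hz.1)).continuousWithinAt) ⟨h2.le, h1'⟩
  exact ⟨y, h1.trans_le hy.1, hy'⟩

/-- The policy can be locally constant, at the kink or at `0`. Strictness comes from the region of
low prices, where `level` is strictly monotone and which has positive probability. -/
theorem cost_strictAntiOn (hp : p.Admissible) {s : ℝ} (hs : p.IsEnvelopeSlope s) :
    StrictAntiOn (p.cost s) (Set.Ioi 0) := by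
  intro y₁ hy₁ y₂ hy₂ h
  have hi₁ := integrable_price_mul_policy hp hs hy₁
  have hi₂ := integrable_price_mul_policy hp hs hy₂
  obtain ⟨l, hl, hls, hlx⟩ := exists_upper_region hp hs p.x₂
  have hmono (n : ℝ) : p.policy s (y₂ * p.price n) ≤ p.policy s (y₁ * p.price n) :=
    policy_antitone hp hs (mul_pos hy₁ (price_pos n))
      (mul_le_mul_of_nonneg_right h.le (price_pos n).le)
  have hstrict {n : ℝ} (hn : p.d (y₂ / l) ≤ n) :
      p.policy s (y₂ * p.price n) < p.policy s (y₁ * p.price n) := by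
    have hP := price_pos (p := p) n
    have h2 := (mul_price_le_iff hp hy₂ hl n).2 hn
    have h12 : y₁ * p.price n < y₂ * p.price n := mul_lt_mul_of_pos_right h hP
    have hw := Real.rpow_pos_of_pos hp.α_pos (1 / p.b)
    have e2 : (y₂ * p.price n) ^ (-1 / p.b) < (y₁ * p.price n) ^ (-1 / p.b) :=
      Real.rpow_lt_rpow_of_neg (mul_pos hy₁ hP) h12
        (div_neg_of_neg_of_pos (by norm_num) hp.b_pos)
    have e3 := mul_le_mul_of_nonneg_left
      (rpow_neg_one_div_anti hp (mul_pos hy₂ hP) h2) hw.le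
    have e4 := mul_lt_mul_of_pos_left e2 hw
    have hα := hp.α_pos
    rw [policy, policy, if_pos (h2.trans hls), if_pos ((h12.le.trans h2).trans hls),
      level_of_upper hp (by linarith), level_of_upper hp (by linarith)]
    gcongr
  rw [← sub_pos, cost, cost, ← integral_sub hi₁ hi₂]
  refine (integral_pos_iff_support_of_nonneg (fun n => ?_) (hi₁.sub hi₂)).2 ?_
  · rw [Pi.zero_apply, Pi.sub_apply, ← mul_sub]
    exact mul_nonneg (price_pos n).le (sub_nonneg.2 (hmono n))
  · refine (pos_iff_ne_zero.2 (stdNormal_Ici_ne_zero (p.d (y₂ / l)))).trans_le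
      (measure_mono fun n hn => ?_)
    rw [Function.mem_support, Pi.sub_apply, ← mul_sub]
    exact (mul_pos (price_pos n) (sub_pos.2 (hstrict hn))).ne'

/-! ### Measurability and integrability of the utility. -/

theorem measurable_utility : Measurable p.utility := by
  have : Measurable p.payoff :=
    Measurable.ite (measurableSet_lt (by fun_prop) (by fun_prop)) measurable_const
      (Measurable.ite (measurableSet_lt (by fun_prop) (by fun_prop)) (by fun_prop) (by fun_prop))
  unfold utility hara
  fun_prop

/-- The utility is squeezed between the constant `U_M(0)` and the supporting line, which is affine
in the integrable fund value. -/
theorem integrable_utility_policy (hp : p.Admissible) {s y : ℝ} (hs : p.IsEnvelopeSlope s)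
    (hy : 0 < y) : Integrable (fun n => p.utility (p.policy s (y * p.price n))) stdNormal := by
  have hi := integrable_policy hp hs hy
  refine integrable_of_le_of_le (measurable_utility.comp ((measurable_policy s).comp
    (measurable_const.mul measurable_price))).aestronglyMeasurable
    (ae_of_all _ fun n => utility_zero_le hp _)
    (ae_of_all _ fun n => utility_le_chord hp hs
      (policy_nonneg hp hs (mul_pos hy (price_pos n))))
    (integrable_const _) ((integrable_const _).add (hi.const_mul s))

/-! ### The terminal value problem -/

section Problem

variable {Ω : Type*} {mΩ : MeasurableSpace Ω} {Q : Measure Ω}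
  {ℱ : Filtration ℝ≥0 mΩ} {W : ℝ≥0 → Ω → ℝ}

theorem spd_pos (t : ℝ≥0) (ω : Ω) : 0 < p.spd W t ω := Real.exp_pos _

theorem spd_eq_price (hp : p.Admissible) (ω : Ω) :
    p.spd W p.T ω = p.price (W p.T ω / √p.T) := by
  have : √(p.T : ℝ) ≠ 0 := (Real.sqrt_pos.2 hp.T_pos).ne'
  rw [spd, price]
  field_simp

theorem hasLaw_stdNormal (hp : p.Admissible) (hW : IsWiener Q ℱ p.T W) :
    HasLaw (fun ω => W p.T ω / √p.T) stdNormal Q := by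
  have h1 := hW.increment_law 0 p.T zero_le le_rfl
  rw [tsub_zero] at h1
  have h2 : HasLaw (W p.T) (gaussianReal 0 p.T) Q := h1.congr (by
    filter_upwards [hW.start_zero] with ω hω
    rw [hω, sub_zero])
  have h3 := gaussianReal_div_const h2 (√p.T)
  rw [zero_div] at h3
  convert h3 using 2
  ext
  have : (p.T : ℝ) ≠ 0 := NNReal.coe_ne_zero.2 hp.T_pos.ne'
  simp [this]

theorem integral_spd (hp : p.Admissible) (hW : IsWiener Q ℱ p.T W) {f : ℝ → ℝ}
    (hf : Measurable f) :
    ∫ ω, f (p.spd W p.T ω) ∂Q = ∫ n, f (p.price n) ∂stdNormal := by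
  simp_rw [spd_eq_price hp]
  exact (hasLaw_stdNormal hp hW).integral_comp
    (hf.comp measurable_price).aestronglyMeasurable

theorem integrable_spd (hp : p.Admissible) (hW : IsWiener Q ℱ p.T W) {f : ℝ → ℝ}
    (hi : Integrable (fun n => f (p.price n)) stdNormal) :
    Integrable (fun ω => f (p.spd W p.T ω)) Q := by
  simp_rw [spd_eq_price hp]
  have h := hasLaw_stdNormal hp hW
  rw [← h.map_eq] at hi
  exact hi.comp_aemeasurable h.aemeasurable

theorem measurable_spd (hW : IsWiener Q ℱ p.T W) : Measurable[ℱ p.T] (p.spd W p.T) := by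
  have := hW.adapted p.T le_rfl
  unfold spd
  fun_prop

variable {s : ℝ} {v : ℝ → ℝ → ℝ}

theorem isMultiplier_iff (hp : p.Admissible) (hW : IsWiener Q ℱ p.T W)
    (hv : ∀ y z, 0 < y → 0 < z → v y z = p.policy s (y * z)) (y : ℝ) :
    p.IsMultiplier Q W v y ↔ 0 < y ∧ p.cost s y = p.v₀ := by
  refine and_congr_right fun hy => ?_
  have h := integral_spd hp hW (f := fun z => z * p.policy s (y * z))
    (measurable_id.mul ((measurable_policy s).comp (measurable_const.mul measurable_id)))
  rw [cost, ← h]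
  simp_rw [hv y _ hy (spd_pos _ _)]

theorem exists_unique_multiplier (hp : p.Admissible) (hW : IsWiener Q ℱ p.T W)
    (hs : p.IsEnvelopeSlope s) (hv : ∀ y z, 0 < y → 0 < z → v y z = p.policy s (y * z)) :
    ∃ y, p.IsMultiplier Q W v y ∧ ∀ y', p.IsMultiplier Q W v y' → y' = y := by
  simp_rw [isMultiplier_iff hp hW hv]
  obtain ⟨y, hy, hc⟩ := exists_cost_eq hp hs
  exact ⟨y, ⟨hy, hc⟩, fun y' h =>
    (cost_strictAntiOn hp hs).injOn h.1 hy (h.2.trans hc.symm)⟩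

variable [IsProbabilityMeasure Q]

/-- Weak duality: the pointwise inequality at the price `y Z_T` is integrated. The policy spends
exactly `v₀` and a competitor at most `v₀`, so the Lagrange term has nonpositive mean. The same
inequality and the lower bound `U_M(0)` make every competitor's utility integrable. -/
theorem isOptimal_policy (hp : p.Admissible) (hW : IsWiener Q ℱ p.T W)
    (hs : p.IsEnvelopeSlope s) {y : ℝ} (hy : 0 < y) (hc : p.cost s y = p.v₀) :
    p.IsOptimal Q ℱ W (fun ω => p.policy s (y * p.spd W p.T ω)) := by
  have hmeas : Measurable[ℱ p.T] (fun ω => p.policy s (y * p.spd W p.T ω)) :=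
    (measurable_policy s).comp (measurable_const.mul (measurable_spd hW))
  have hZ : Measurable (p.spd W p.T) := (measurable_spd hW).mono (ℱ.le _) le_rfl
  have hnn (ω : Ω) : 0 ≤ p.policy s (y * p.spd W p.T ω) :=
    policy_nonneg hp hs (mul_pos hy (spd_pos _ _))
  have hcost : ∫ ω, p.spd W p.T ω * p.policy s (y * p.spd W p.T ω) ∂Q = p.v₀ := by
    rw [← hc, cost]
    exact integral_spd hp hW (f := fun z => z * p.policy s (y * z))
      (measurable_id.mul ((measurable_policy s).comp (measurable_const.mul measurable_id)))
  have hi := integrable_spd hp hW (f := fun z => z * p.policy s (y * z))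
    (integrable_price_mul_policy hp hs hy)
  have hU := integrable_spd hp hW (f := fun z => p.utility (p.policy s (y * z)))
    (integrable_utility_policy hp hs hy)
  refine ⟨⟨hmeas, ae_of_all _ hnn, ?_⟩, hU, fun V hV => ?_⟩
  · rw [← ofReal_integral_eq_lintegral_ofReal hi
      (ae_of_all _ fun ω => mul_nonneg (spd_pos _ _).le (hnn ω)), hcost]
  · have hVm : Measurable V := hV.measurable.mono (ℱ.le _) le_rfl
    have hVnn : 0 ≤ᵐ[Q] fun ω => p.spd W p.T ω * V ω := by
      filter_upwards [hV.nonneg] with ω hω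
      exact mul_nonneg (spd_pos _ _).le hω
    have hVi : Integrable (fun ω => p.spd W p.T ω * V ω) Q := by
      refine ⟨(hZ.mul hVm).aestronglyMeasurable, ?_⟩
      rw [hasFiniteIntegral_iff_ofReal hVnn]
      exact hV.budget.trans_lt ENNReal.ofReal_lt_top
    have hVle : ∫ ω, p.spd W p.T ω * V ω ∂Q ≤ p.v₀ := by
      rw [integral_eq_lintegral_of_nonneg_ae hVnn hVi.1]
      exact ENNReal.toReal_le_of_le_ofReal hp.v₀_pos.le hV.budget
    have hD : Integrable (fun ω => y * (p.spd W p.T ω * V ω -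
        p.spd W p.T ω * p.policy s (y * p.spd W p.T ω))) Q := (hVi.sub hi).const_mul y
    have hle : ∀ᵐ ω ∂Q, p.utility (V ω) ≤ p.utility (p.policy s (y * p.spd W p.T ω)) +
        y * (p.spd W p.T ω * V ω - p.spd W p.T ω * p.policy s (y * p.spd W p.T ω)) := by
      filter_upwards [hV.nonneg] with ω hω
      have := utility_sub_le_policy hp hs (mul_pos hy (spd_pos (W := W) (p := p) p.T ω)) hω
      linarith
    have hVU : Integrable (fun ω => p.utility (V ω)) Q :=
      integrable_of_le_of_le (measurable_utility.comp hVm).aestronglyMeasurable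
        (ae_of_all _ fun ω => utility_zero_le hp _) hle (integrable_const _) (hU.add hD)
    refine ⟨hVU, (integral_mono_ae hVU (hU.add hD) hle).trans ?_⟩
    simp only [Pi.add_apply]
    rw [integral_add hU hD, integral_const_mul, integral_sub hVi hi, hcost]
    linarith [mul_nonneg hy.le (sub_nonneg.2 hVle)]

/-- The solution of the problem, given the closed formula for the expected utility. -/
theorem exists_solution (hp : p.Admissible) (hW : IsWiener Q ℱ p.T W)
    (hs : p.IsEnvelopeSlope s) (hv : ∀ y z, 0 < y → 0 < z → v y z = p.policy s (y * z))
    {value : ℝ → ℝ} (hval : ∀ y, 0 < y →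
      ∫ n, p.utility (p.policy s (y * p.price n)) ∂stdNormal = value y) :
    ∃ y, (p.IsMultiplier Q W v y ∧ ∀ y', p.IsMultiplier Q W v y' → y' = y) ∧
      p.IsOptimal Q ℱ W (fun ω => v y (p.spd W p.T ω)) ∧
      ∀ V : Ω → ℝ, p.IsOptimal Q ℱ W V → ∫ ω, p.utility (V ω) ∂Q = value y := by
  obtain ⟨y, hm, hu⟩ := exists_unique_multiplier hp hW hs hv
  obtain ⟨hy, hc⟩ := (isMultiplier_iff hp hW hv y).1 hm
  have hopt := isOptimal_policy hp hW hs hy hc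
  refine ⟨y, ⟨hm, hu⟩, ?_, fun V hV => ?_⟩
  · simp_rw [hv y _ hy (spd_pos _ _)]
    exact hopt
  · rw [← hval y hy, ← integral_spd hp hW (f := fun z => p.utility (p.policy s (y * z)))
      (measurable_utility.comp ((measurable_policy s).comp (measurable_const.mul measurable_id)))]
    exact le_antisymm (hopt.maximal V hV.feasible).2 (hV.maximal _ hopt.feasible).2

end Problem

/-! ### The closed formulas for the expected utility -/

theorem setIntegral_const_Iio (c q : ℝ) :
    ∫ _ in Set.Iio q, c ∂stdNormal = c * Φ q := by
  rw [setIntegral_const, Φ_eq, smul_eq_mul, mul_comm]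

theorem setIntegral_Ico {f : ℝ → ℝ} (hf : Integrable f stdNormal) {q q' : ℝ} (h : q ≤ q') :
    ∫ n in Set.Ico q q', f n ∂stdNormal =
      ∫ n in Set.Ici q, f n ∂stdNormal - ∫ n in Set.Ici q', f n ∂stdNormal := by
  rw [← Set.Ico_union_Ici_eq_Ici h, setIntegral_union
    (Set.disjoint_left.2 fun _ h1 h2 => (h1.2.trans_le h2).false) measurableSet_Ici
    hf.integrableOn hf.integrableOn]
  ring

theorem setIntegral_const_Ico (c : ℝ) {q q' : ℝ} (h : q ≤ q') :
    ∫ _ in Set.Ico q q', c ∂stdNormal = c * (Φ q' - Φ q) := by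
  rw [setIntegral_Ico (integrable_const c) h, setIntegral_const, setIntegral_const,
    stdNormal_real_Ici, stdNormal_real_Ici, smul_eq_mul, smul_eq_mul]
  ring

theorem setIntegral_price_rpow_Ico (hp : p.Admissible) {q q' : ℝ} (h : q ≤ q') :
    ∫ n in Set.Ico q q', p.price n ^ ((p.b - 1) / p.b) ∂stdNormal =
      p.ξ₁ * (Φ (q' + p.shift) - Φ (q + p.shift)) := by
  rw [setIntegral_Ico (integrable_price_rpow _) h, setIntegral_price_rpow hp,
    setIntegral_price_rpow hp]
  ring

theorem integral_eq_Iio_add_Ici {f : ℝ → ℝ} (hf : Integrable f stdNormal) (q : ℝ) :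
    ∫ n, f n ∂stdNormal =
      ∫ n in Set.Iio q, f n ∂stdNormal + ∫ n in Set.Ici q, f n ∂stdNormal := by
  rw [← integral_add_compl measurableSet_Iio hf, Set.compl_Iio]

/-- Here the optimal shifted wealth is `α ^ (1 / b) (y l) ^ (-1 / b)`, so the utility is a pure
power of `l`. -/
theorem utility_upper (hp : p.Admissible) {y l : ℝ} (hy : 0 < y) (hl : 0 < l)
    (h : p.x₂ ≤ p.α ^ (1 / p.b) * (y * l) ^ (-1 / p.b)) :
    p.utility (p.level ((y * l) ^ (-1 / p.b))) =
      (1 - p.b)⁻¹ * y ^ ((p.b - 1) / p.b) * p.α ^ ((1 - p.b) / p.b) *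
        l ^ ((p.b - 1) / p.b) := by
  have hα := hp.α_pos
  have hb := hp.b_pos.ne'
  have hyl := mul_pos hy hl
  rw [level_of_upper hp h, utility_of_top_le hp
    (le_add_of_nonneg_right (div_nonneg (sub_nonneg.2 h) hα.le)), add_sub_cancel_left,
    mul_div_cancel₀ _ hα.ne', add_sub_cancel,
    Real.mul_rpow (Real.rpow_nonneg hα.le _) (Real.rpow_nonneg hyl.le _),
    ← Real.rpow_mul hα.le, ← Real.rpow_mul hyl.le, Real.mul_rpow hy.le hl.le,
    show 1 / p.b * (1 - p.b) = (1 - p.b) / p.b by ring,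
    show -1 / p.b * (1 - p.b) = (p.b - 1) / p.b by ring]
  ring

theorem setIntegral_utility_below (hp : p.Admissible) {s y : ℝ} (hs : 0 < s) (hy : 0 < y) :
    ∫ n in Set.Iio (p.d (y / s)), p.utility (p.policy s (y * p.price n)) ∂stdNormal =
      p.utility 0 * Φ (p.d (y / s)) := by
  rw [← setIntegral_const_Iio]
  refine setIntegral_congr_fun measurableSet_Iio fun n hn => ?_
  have := (lt_mul_price_iff hp hy hs n).2 hn
  simp only [policy, if_neg (not_le.2 this)]

theorem setIntegral_utility_upper (hp : p.Admissible) {s y q : ℝ} (hy : 0 < y)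
    (h : ∀ n, q ≤ n → y * p.price n ≤ s ∧
      p.x₂ ≤ p.α ^ (1 / p.b) * (y * p.price n) ^ (-1 / p.b)) :
    ∫ n in Set.Ici q, p.utility (p.policy s (y * p.price n)) ∂stdNormal =
      (1 - p.b)⁻¹ * y ^ ((p.b - 1) / p.b) * p.α ^ ((1 - p.b) / p.b) * p.ξ₁ *
        (1 - Φ (q + p.shift)) := by
  rw [mul_assoc _ p.ξ₁, ← setIntegral_price_rpow hp, ← integral_const_mul]
  refine setIntegral_congr_fun measurableSet_Ici fun n hn => ?_
  simp only [policy, if_pos (h n hn).1]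
  exact utility_upper hp hy (price_pos n) (h n hn).2

theorem integral_utility_fundA (hp : p.Admissible) {θ y : ℝ} (hθ : p.IsThetaA θ) (hy : 0 < y) :
    ∫ n, p.utility (p.policy (p.slopeA θ) (y * p.price n)) ∂stdNormal = p.valueA θ y := by
  have hs := isEnvelopeSlope_slopeA hp hθ
  rw [integral_eq_Iio_add_Ici (integrable_utility_policy hp hs hy) (p.d (y / p.slopeA θ)),
    setIntegral_utility_below hp hs.pos hy, setIntegral_utility_upper hp hy]
  · rfl
  · intro n hn
    have h := (mul_price_le_iff hp hy hs.pos n).2 hn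
    exact ⟨h, upper_wealth_of_le_slopeA hp hθ (mul_pos hy (price_pos n)) h⟩

theorem div_upper_threshold (hp : p.Admissible) (y : ℝ) :
    y * p.α⁻¹ * p.x₂ ^ p.b = y / (p.α * p.x₂ ^ (-p.b)) := by
  rw [Real.rpow_neg hp.x₂_nonneg]
  field_simp

theorem div_lower_threshold (hp : p.Admissible) (y : ℝ) :
    y * p.x₂ ^ p.b = y / p.x₂ ^ (-p.b) := by
  rw [Real.rpow_neg hp.x₂_nonneg, div_inv_eq_mul]

theorem d_div_anti (hp : p.Admissible) {y s s' : ℝ} (hy : 0 < y) (hs : 0 < s) (h : s ≤ s') :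
    p.d (y / s') ≤ p.d (y / s) :=
  d_le_d hp (div_pos hy (hs.trans_le h)) (div_le_div_of_nonneg_left hy.le hs h)

theorem upper_threshold_pos (hp : p.Admissible) (hx : 0 < p.x₂) :
    0 < p.α * p.x₂ ^ (-p.b) := mul_pos hp.α_pos (Real.rpow_pos_of_pos hx _)

/-- The end `s'` of the kink region is kept apart from the cutoff `s`: in Case B both are `H`, while
in Case C `s'` is `x₂ ^ (-b)`, below the cutoff. -/
theorem setIntegral_utility_kink (hp : p.Admissible) (hx : 0 < p.x₂) {s s' y : ℝ} (hy : 0 < y)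
    (hs : s' ≤ s) (h1 : p.α * p.x₂ ^ (-p.b) ≤ s') (h2 : s' ≤ p.x₂ ^ (-p.b)) :
    ∫ n in Set.Ico (p.d (y / s')) (p.d (y / (p.α * p.x₂ ^ (-p.b)))),
      p.utility (p.policy s (y * p.price n)) ∂stdNormal =
      (1 - p.b)⁻¹ * p.x₂ ^ (1 - p.b) *
        (Φ (p.d (y / (p.α * p.x₂ ^ (-p.b)))) - Φ (p.d (y / s'))) := by
  have h0 := upper_threshold_pos hp hx
  rw [← setIntegral_const_Ico _ (d_div_anti hp hy h0 h1)]
  refine setIntegral_congr_fun measurableSet_Ico fun n hn => ?_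
  have hn1 := (mul_price_le_iff hp hy (h0.trans_le h1) n).2 hn.1
  have hn2 := (lt_mul_price_iff hp hy h0 n).2 hn.2
  simp only [policy, if_pos (hn1.trans hs)]
  rw [level_eq_kink hp hx (mul_pos hy (price_pos n)) hn2.le (hn1.trans h2),
    utility_of_top_le hp le_rfl, sub_self, mul_zero, add_zero, one_div]

theorem setIntegral_utility_top (hp : p.Admissible) (hx : 0 < p.x₂) {s y : ℝ} (hy : 0 < y)
    (hs : p.α * p.x₂ ^ (-p.b) ≤ s) :
    ∫ n in Set.Ici (p.d (y / (p.α * p.x₂ ^ (-p.b)))),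
      p.utility (p.policy s (y * p.price n)) ∂stdNormal =
      (1 - p.b)⁻¹ * y ^ ((p.b - 1) / p.b) * p.α ^ ((1 - p.b) / p.b) * p.ξ₁ *
        (1 - Φ (p.d (y / (p.α * p.x₂ ^ (-p.b))) + p.shift)) := by
  refine setIntegral_utility_upper hp hy fun n hn => ?_
  have h := (mul_price_le_iff hp hy (upper_threshold_pos hp hx) n).2 hn
  exact ⟨h.trans hs, (x₂_le_upper_iff hp hx (mul_pos hy (price_pos n))).2 h⟩

theorem setIntegral_Ici_eq_add {f : ℝ → ℝ} (hf : Integrable f stdNormal) {q q' : ℝ}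
    (h : q ≤ q') : ∫ n in Set.Ici q, f n ∂stdNormal =
      ∫ n in Set.Ico q q', f n ∂stdNormal + ∫ n in Set.Ici q', f n ∂stdNormal := by
  rw [setIntegral_Ico hf h, sub_add_cancel]

theorem integral_utility_fundB (hp : p.Admissible) (hB : p.CaseB) {y : ℝ} (hy : 0 < y) :
    ∫ n, p.utility (p.policy p.slopeB (y * p.price n)) ∂stdNormal = p.valueB y := by
  have hs := isEnvelopeSlope_slopeB hp hB
  have hx := CaseB.x₂_pos hp hB
  have h12 := CaseB.le_slopeB hp hB
  have hi := integrable_utility_policy hp hs hy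
  rw [integral_eq_Iio_add_Ici hi (p.d (y / p.slopeB)),
    setIntegral_Ici_eq_add hi (d_div_anti hp hy (upper_threshold_pos hp hx) h12),
    setIntegral_utility_below hp hs.pos hy,
    setIntegral_utility_kink hp hx hy le_rfl h12 (CaseB.slopeB_le hp hB),
    setIntegral_utility_top hp hx hy h12, valueB, dB₂, dB₃, div_upper_threshold hp]
  ring

theorem setIntegral_utility_lower (hp : p.Admissible) {θ y : ℝ} (hθ : p.IsThetaC θ)
    (hy : 0 < y) :
    ∫ n in Set.Ico (p.d (y / p.slopeC θ)) (p.d (y / p.x₂ ^ (-p.b))),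
      p.utility (p.policy (p.slopeC θ) (y * p.price n)) ∂stdNormal =
      (1 - p.b)⁻¹ * y ^ ((p.b - 1) / p.b) * p.ξ₁ *
        (Φ (p.d (y / p.x₂ ^ (-p.b)) + p.shift) - Φ (p.d (y / p.slopeC θ) + p.shift)) := by
  have hx := hθ.x₂_pos hp
  have hs := isEnvelopeSlope_slopeC hp hθ
  have h0 : 0 < p.x₂ ^ (-p.b) := Real.rpow_pos_of_pos hx _
  have hb := hp.b_pos.ne'
  rw [mul_assoc _ p.ξ₁,
    ← setIntegral_price_rpow_Ico hp (d_div_anti hp hy h0 (hθ.lt_slopeC hp).le),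
    ← integral_const_mul]
  refine setIntegral_congr_fun measurableSet_Ico fun n hn => ?_
  have hP := price_pos (p := p) n
  have hl := mul_pos hy hP
  have hn1 := (mul_price_le_iff hp hy hs.pos n).2 hn.1
  have hn2 := (lt_mul_price_iff hp hy h0 n).2 hn.2
  have hfl := floor_le_level hp hs hl hn1
  have hlev := level_eq_lower hp hx hl hn2.le
  have hle : (y * p.price n) ^ (-1 / p.b) ≤ p.x₂ := by
    by_contra h
    exact hn2.not_ge ((x₂_le_lower_iff hp hx hl).1 (not_le.1 h).le)
  simp only [policy, if_pos hn1]
  rw [utility_of_le_top hp hfl (by linarith), hlev, add_sub_cancel_left, add_sub_cancel,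
    ← Real.rpow_mul hl.le, Real.mul_rpow hy.le hP.le,
    show -1 / p.b * (1 - p.b) = (p.b - 1) / p.b by ring]
  ring

theorem integral_utility_fundC (hp : p.Admissible) {θ y : ℝ} (hθ : p.IsThetaC θ) (hy : 0 < y) :
    ∫ n, p.utility (p.policy (p.slopeC θ) (y * p.price n)) ∂stdNormal = p.valueC θ y := by
  have hs := isEnvelopeSlope_slopeC hp hθ
  have hx := hθ.x₂_pos hp
  have h12 := α_mul_le hp hx
  have h23 := (hθ.lt_slopeC hp).le
  have hi := integrable_utility_policy hp hs hy
  have h0 := upper_threshold_pos hp hx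
  rw [integral_eq_Iio_add_Ici hi (p.d (y / p.slopeC θ)),
    setIntegral_Ici_eq_add hi (d_div_anti hp hy (h0.trans_le h12) h23),
    setIntegral_Ici_eq_add hi (d_div_anti hp hy h0 h12),
    setIntegral_utility_below hp hs.pos hy, setIntegral_utility_lower hp hθ hy,
    setIntegral_utility_kink hp hx hy h23 h12 le_rfl,
    setIntegral_utility_top hp hx hy (h12.trans h23), valueC, dC₂, dC₃, dC₄,
    div_upper_threshold hp, div_lower_threshold hp]
  ring

end Model

end FirstLoss

end

/-! ### The three cases assembled. -/

theorem mainTheorem4 {Ω : Type*} {mΩ : MeasurableSpace Ω} (Q : Measure Ω)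
    [IsProbabilityMeasure Q] (ℱ : Filtration ℝ≥0 mΩ) (W : ℝ≥0 → Ω → ℝ)
    (p : FirstLoss.Model) (hp : p.Admissible) (hW : FirstLoss.IsWiener Q ℱ p.T W) :
    -- Case A
    (p.CaseA → ∃ θ y : ℝ,
      (p.IsThetaA θ ∧ ∀ θ', p.IsThetaA θ' → θ' = θ) ∧
      (p.IsMultiplier Q W (p.fundA θ) y ∧
        ∀ y', p.IsMultiplier Q W (p.fundA θ) y' → y' = y) ∧
      p.IsOptimal Q ℱ W (fun ω => p.fundA θ y (p.spd W p.T ω)) ∧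
      ∀ V : Ω → ℝ, p.IsOptimal Q ℱ W V → ∫ ω, p.utility (V ω) ∂Q = p.valueA θ y) ∧
    -- Case B
    (p.CaseB → ∃ y : ℝ,
      (p.IsMultiplier Q W p.fundB y ∧
        ∀ y', p.IsMultiplier Q W p.fundB y' → y' = y) ∧
      p.IsOptimal Q ℱ W (fun ω => p.fundB y (p.spd W p.T ω)) ∧
      ∀ V : Ω → ℝ, p.IsOptimal Q ℱ W V → ∫ ω, p.utility (V ω) ∂Q = p.valueB y) ∧
    -- Case C
    (p.CaseC → ∃ θ y : ℝ,
      (p.IsThetaC θ ∧ ∀ θ', p.IsThetaC θ' → θ' = θ) ∧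
      (p.IsMultiplier Q W (p.fundC θ) y ∧
        ∀ y', p.IsMultiplier Q W (p.fundC θ) y' → y' = y) ∧
      p.IsOptimal Q ℱ W (fun ω => p.fundC θ y (p.spd W p.T ω)) ∧
      ∀ V : Ω → ℝ, p.IsOptimal Q ℱ W V → ∫ ω, p.utility (V ω) ∂Q = p.valueC θ y) := by
  refine ⟨fun hA => ?_, fun hB => ?_, fun hC => ?_⟩
  · obtain ⟨θ, hθ⟩ := FirstLoss.Model.isThetaA_exists hp hA
    obtain ⟨y, h⟩ := FirstLoss.Model.exists_solution hp hW
      (FirstLoss.Model.isEnvelopeSlope_slopeA hp hθ)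
      (fun _ _ => FirstLoss.Model.fundA_eq_policy hp hθ)
      (fun _ => FirstLoss.Model.integral_utility_fundA hp hθ)
    exact ⟨θ, y, ⟨hθ, fun _ => FirstLoss.Model.isThetaA_unique hp hθ⟩, h⟩
  · exact FirstLoss.Model.exists_solution hp hW (FirstLoss.Model.isEnvelopeSlope_slopeB hp hB)
      (fun _ _ => FirstLoss.Model.fundB_eq_policy hp hB)
      (fun _ => FirstLoss.Model.integral_utility_fundB hp hB)
  · obtain ⟨θ, hθ⟩ := FirstLoss.Model.isThetaC_exists hp hC
    obtain ⟨y, h⟩ := FirstLoss.Model.exists_solution hp hW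
      (FirstLoss.Model.isEnvelopeSlope_slopeC hp hθ)
      (fun _ _ => FirstLoss.Model.fundC_eq_policy hp hθ)
      (fun _ => FirstLoss.Model.integral_utility_fundC hp hθ)
    exact ⟨θ, y, ⟨hθ, fun _ => FirstLoss.Model.isThetaC_unique hp hθ⟩, h⟩
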